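/- Let $\mathcal G$ be a causal diagram on a finite set $\mathbf V$ of endogenous variables: it has directed arrows, and bi-directed arrows that stand for unobserved confounders. A temporal ordering of $\mathbf V$ (a linear order that is a topological order of the directed arrows) and a set $\mathbf O\subseteq\mathbf V$ of observed variables are fixed. Let $\mathbf X=\{X_1,\dots,X_n\}\subseteq\mathbf O$ be the actions, listed in temporal order, and let $Y\in\mathbf V\setminus\mathbf X$ be the target. Write $\mathrm{before}(X_i)$ for the set of observed variables that precede $X_i$. For sets $\mathbf Z_1\subseteq \mathrm{before}(X_1),\dots,\mathbf Z_n\subseteq\mathrm{before}(X_n)$ let $\mathcal G'_i$ be the graph obtained from $\mathcal G$ by removing all (directed and bi-directed) arrows into $X_{i+1},\dots,X_n$ and adding the arrows $\mathbf Z_{j}\to X_{j}$ for all $j>i$. The sets $\mathbf Z_1,\dots,\mathbf Z_n$ satisfy the sequential $\pi$-backdoor criterion for $(\mathcal G,\mathbf X,Y)$ if for every $i$ either (1) $X_i$ and $Y$ are d-separated by $\mathbf Z_i$ in $\mathcal G'_i$ with the arrows out of $X_i$ removed, or (2) $X_i$ is not an ancestor of $Y$ in $\mathcal G'_i$. A policy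 $\pi$ consists of one stochastic decision rule $\pi_i(x_i\mid \mathbf c_i)$ for each $i$, where the covariates $\mathbf C_i\subseteq\mathrm{before}(X_i)$ may be chosen freely, and $P(\cdot\mid do(\pi))$ is the distribution obtained when these rules replace the structural functions of the actions. $\mathbf X$ is imitable with respect to $Y$ in $\mathcal G$ if, for all finite domains of the variables, a policy $\pi$ can be determined from the observational distribution $P(\mathbf O)$ alone such that $P(Y\mid do(\pi))_M=P(Y)_M$ for every structural causal model $M$ that is compatible with $\mathcal G$, has these domains, and has this observational distribution. Theorem. If no sets $\mathbf Z_1\subseteq\mathrm{before}(X_1),\dots,\mathbf Z_n\subseteq\mathrm{before}(X_n)$ satisfy the sequential $\pi$-backdoor criterion for $(\mathcal G,\mathbf X,Y)$, then $\mathbf X$ is not imitable with respect to $Y$ in $\mathcal G$. -/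

import Mathlib

open scoped BigOperators

universe u

/-! ### Mixed graphs, d-separation -/

/-- A mixed graph on `V`: `dir a b` is the arrow `a → b`, `bi a b` the bi-directed arrow
`a ↔ b`. Both kinds of arrow may be present between the same two nodes. -/
structure MixedGraph (V : Type u) where
  dir : V → V → Prop
  bi : V → V → Prop

/-- The three ways in which a path can traverse an edge from a node `a` to the next node `b`:
`a → b`, `a ← b`, `a ↔ b`. -/
inductive EdgeKind
  | forward
  | backward
  | bidirected

namespace EdgeKind

/-- The edge has an arrowhead at the node at which it is entered. -/
def headAtSource : EdgeKind → Prop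
  | forward => False
  | backward => True
  | bidirected => True

/-- The edge has an arrowhead at the node to which it leads. -/
def headAtTarget : EdgeKind → Prop
  | forward => True
  | backward => False
  | bidirected => True

end EdgeKind

namespace MixedGraph

variable {V : Type u}

/-- `H` contains an edge that can be traversed from `a` to `b` in the way `k`. -/
def Joins (H : MixedGraph V) : EdgeKind → V → V → Prop
  | EdgeKind.forward, a, b => H.dir a b
  | EdgeKind.backward, a, b => H.dir b a
  | EdgeKind.bidirected, a, b => H.bi a b ∨ H.bi b a

/-- `An(W)`: the nodes with a (possibly empty) directed path into `W`, so `W` is included. -/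
def An (H : MixedGraph V) (W : Set V) : Set V :=
  {a | ∃ w ∈ W, Relation.ReflTransGen H.dir a w}

/-- There is a path (without repeated nodes) from `a` to `b` that is active given `W`. The path
has the nodes `p 0, …, p n` and the edges `e 0, …, e (n - 1)`, where `e i` joins `p i` and
`p (i + 1)`. Every collider on it lies in `An(W)`, and no other node on it, the two ends
included, lies in `W`. -/
def ActivePath (H : MixedGraph V) (W : Set V) (a b : V) : Prop :=
  ∃ (n : ℕ) (p : ℕ → V) (e : ℕ → EdgeKind),
    p 0 = a ∧ p n = b ∧
    (∀ i j, i ≤ n → j ≤ n → p i = p j → i = j) ∧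
    (∀ i, i < n → H.Joins (e i) (p i) (p (i + 1))) ∧
    ∀ i, i ≤ n →
      let IsCollider : Prop :=
        0 < i ∧ i < n ∧ (e (i - 1)).headAtTarget ∧ (e i).headAtSource
      (IsCollider → p i ∈ H.An W) ∧ (¬ IsCollider → p i ∉ W)

/-- d-separation of two nodes: `(a ⫫ b | W)` in `H`. -/
def DSep (H : MixedGraph V) (a b : V) (W : Set V) : Prop :=
  ¬ H.ActivePath W a b

/-- The graph obtained by removing the arrows `x → b` out of `x`. -/
def removeOut (H : MixedGraph V) (x : V) : MixedGraph V where
  dir a b := H.dir a b ∧ a ≠ x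
  bi := H.bi

end MixedGraph

/-! ### Causal diagrams and the sequential π-backdoor criterion -/

/-- A causal diagram on the endogenous variables `V`, whose linear order is the temporal
ordering: a topological order of the directed part. The variables outside `observed` are
latent. Exogenous variables are not nodes; unobserved confounders are bi-directed arrows. -/
structure CausalDiagram (V : Type u) [LinearOrder V] extends MixedGraph V where
  observed : Set V
  dir_lt : ∀ a b, dir a b → a < b
  bi_symm : ∀ a b, bi a b → bi b a
  bi_irrefl : ∀ a, ¬ bi a a

namespace CausalDiagram

variable {V : Type u} [LinearOrder V]

/-- The observed variables that come strictly before `x` in the temporal ordering: what the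
imitator can know when it acts at `x`. -/
def before (G : CausalDiagram V) (x : V) : Set V :=
  {z | z ∈ G.observed ∧ z < x}

/-- The manipulated graph `G'_x` for the action `x ∈ X`: all arrows (directed and bi-directed)
into the actions after `x` are removed, and arrows from `Z x'` into every such action `x'`
are added. -/
def manipulated (G : CausalDiagram V) (X : Finset V) (Z : V → Set V) (x : V) :
    MixedGraph V where
  dir a b := (¬ (b ∈ X ∧ x < b) ∧ G.dir a b) ∨ ((b ∈ X ∧ x < b) ∧ a ∈ Z b)
  bi a b := G.bi a b ∧ ¬ (a ∈ X ∧ x < a) ∧ ¬ (b ∈ X ∧ x < b)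

/-- The covariate sets `Z x` (only those with `x ∈ X` matter) satisfy the sequential
π-backdoor criterion for `(G, X, Y)`. -/
def IsSeqPiBackdoor (G : CausalDiagram V) (X : Finset V) (Y : V) (Z : V → Set V) : Prop :=
  (∀ x ∈ X, Z x ⊆ G.before x) ∧
  ∀ x ∈ X,
    ((G.manipulated X Z x).removeOut x).DSep x Y (Z x) ∨
    x ∉ (G.manipulated X Z x).An {Y}

end CausalDiagram

/-! ### Structural causal models, policies, imitability -/

/-- A structural causal model with endogenous variables `V`, where `i : V` has the finite domain
`dom i`. The exogenous variables `e : Exo` are drawn independently from the distributions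
`exoDist e`. The structural function of `i` has as arguments the endogenous variables in `pa i`
and the exogenous variables in `exoArgs i`. A confounder is an exogenous variable that is an
argument of several structural functions. -/
structure SCM (V : Type u) (dom : V → Type) where
  Exo : Type u
  exoFintype : Fintype Exo
  exoDom : Exo → Type
  exoDomFintype : ∀ e, Fintype (exoDom e)
  exoDist : ∀ e, stdSimplex ℝ (exoDom e)
  pa : V → Set V
  exoArgs : V → Set Exo
  func : ∀ i : V, (∀ w : pa i, dom w) → (∀ e : exoArgs i, exoDom e) → dom i

attribute [instance] SCM.exoFintype SCM.exoDomFintype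

/-- A policy on the actions `X`: for every action `x ∈ X`, a set of covariates that are observed
before `x`, and a decision rule that maps values of these covariates to a probability
distribution on the domain of `x`. -/
structure Policy {V : Type u} [LinearOrder V] (G : CausalDiagram V) (X : Finset V)
    (dom : V → Type) [∀ i, Fintype (dom i)] where
  cov : V → Set V
  cov_subset : ∀ x ∈ X, cov x ⊆ G.before x
  rule : ∀ x ∈ X, (∀ z : cov x, dom z) → stdSimplex ℝ (dom x)

namespace SCM

variable {V : Type u} [LinearOrder V] {dom : V → Type}

/-- `M` is compatible with `G`: the causal diagram of `M` is `G`. -/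
def Compatible (M : SCM V dom) (G : CausalDiagram V) : Prop :=
  (∀ a b, a ∈ M.pa b ↔ G.dir a b) ∧
  ∀ a b, G.bi a b ↔ a ≠ b ∧ ∃ e, e ∈ M.exoArgs a ∧ e ∈ M.exoArgs b

variable [Fintype V]

open Classical in
/-- The distribution `P(v)` that `M` induces on the endogenous variables:
`∑_u P(u) ∏_i 1[v_i = f_i(pa_i, u_i)]`. -/
noncomputable def prob (M : SCM V dom) (v : ∀ i, dom i) : ℝ :=
  ∑ u : (∀ e, M.exoDom e), (∏ e, (M.exoDist e).1 (u e)) *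
    ∏ i, if v i = M.func i (fun w => v w) (fun e => u e) then 1 else 0

open Classical in
/-- The distribution `P(v | do(π))`, in which the decision rules of `π` replace the structural
functions of the actions:
`∑_u P(u) ∏_{i ∉ X} 1[v_i = f_i(pa_i, u_i)] ∏_{x ∈ X} π_x(v_x | z_x)`. -/
noncomputable def probDo [∀ i, Fintype (dom i)] {G : CausalDiagram V} {X : Finset V}
    (M : SCM V dom) (π : Policy G X dom) (v : ∀ i, dom i) : ℝ :=
  ∑ u : (∀ e, M.exoDom e), (∏ e, (M.exoDist e).1 (u e)) *
    ∏ i, if h : i ∈ X then (π.rule i h (fun z => v z)).1 (v i)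
      else if v i = M.func i (fun w => v w) (fun e => u e) then 1 else 0

end SCM

section Marginals

variable {V : Type u} [Fintype V] [LinearOrder V] {dom : V → Type} [∀ i, Fintype (dom i)]

open Classical in
/-- The marginal on the variables in `S` of a distribution `q` on all endogenous variables. -/
noncomputable def marginal (q : (∀ i, dom i) → ℝ) (S : Set V) (s : ∀ i : S, dom i) : ℝ :=
  ∑ v : (∀ i, dom i), if (∀ i : S, v i = s i) then q v else 0

end Marginals

/-- `Y` is imitable with respect to the actions `X` in `G`: for all (finite, non-empty) domains
of the variables, a policy can be determined from the observational distribution `P(O)` alone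
(here `p`) such that `P(Y | do(π)) = P(Y)` in every structural causal model that is compatible
with `G` and has that observational distribution. -/
def CausalDiagram.Imitable {V : Type u} [Fintype V] [LinearOrder V] (G : CausalDiagram V)
    (X : Finset V) (Y : V) : Prop :=
  ∀ (dom : V → Type) [∀ i, Fintype (dom i)] [∀ i, Nonempty (dom i)]
    (p : (∀ i : G.observed, dom i) → ℝ),
    ∃ π : Policy G X dom, ∀ M : SCM V dom, M.Compatible G →
      marginal M.prob G.observed = p →
      marginal (M.probDo π) {Y} = marginal M.prob {Y}

/-!
Imitation is obstructed as follows. Let `S` be a set of nodes whose true values the target is able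
to check. It may be enlarged by every *relevant* node (`CausalDiagram.Relevant`): by the parents of
its non-action nodes, and by each observed non-action `z` that is a natural ancestor of an action
`x ∈ S` and is connected with the part of `S \ X` after `x` along a hidden path, on which all
non-colliders are latent and all colliders are checked by the target (`CausalDiagram.Link`). An
action `z` with the same two properties is *exposed* (`CausalDiagram.Exposed`).

If enlarging `{Y}` ends in a closed set `S` without exposed action, then the covariates
`S ∩ before x` satisfy the sequential π-backdoor criterion
(`CausalDiagram.isSeqPiBackdoor_closureCov`): an active path from `x` to the target, walked from
its first node after `x` back to `x`, is a hidden path that exposes `x`.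

Otherwise some action becomes exposed, and one model defeats all policies. Models are handled as
games (`CausalDiagram.Game`) with a test on the public values of the nodes in a set `S`; the test
succeeds when nobody interferes, and `S` is *hard* if for some game no policy passes with
certainty, even when it sees the public values of all earlier nodes. Hardness passes from
`insert v S` to `S` for relevant `v`. A parent is simply copied by its child
(`CausalDiagram.Hard.of_parent`). For `z` related to `x` by a hidden path there is a one-time
signature (`CausalDiagram.Hard.of_link`): a random function `s : Pub → ZMod 2` is shared along the
path, `z` sends its value `b` with the tag `s b` down to `x`, every collider displays the sum of the
two functions that meet there, and the last node displays its own. The test recovers `s` as the sum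
of all displays and compares it with the claim of `x`. Changing all shared functions at a single
argument `c ≠ b` is invisible before the last node (`CausalDiagram.Game.swap_invisible`), so `x`
cannot claim `c` with a tag that is always correct (`CausalDiagram.Game.claim_eq`). If `z` is itself
an action, it does not know any tag, so no policy passes the test (`CausalDiagram.Hard.of_exposed`).
Finally, if `{Y}` is hard, the game is a structural causal model in which the test holds almost
surely for the natural target, and fails with positive probability under every policy
(`CausalDiagram.Hard.not_imitable`).
-/

/-! ### Hidden links to the future, and the closure of the target -/

theorem EdgeKind.headAtSource_of_ne {k : EdgeKind} (h : k ≠ .forward) : k.headAtSource := by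
  cases k
  exacts [(h rfl).elim, trivial, trivial]

theorem EdgeKind.headAtTarget_of_ne {k : EdgeKind} (h : k ≠ .backward) : k.headAtTarget := by
  cases k
  exacts [trivial, (h rfl).elim, trivial]

theorem MixedGraph.reflTransGen_of_removeOut {V : Type u} {H : MixedGraph V} {x a w : V}
    (h : Relation.ReflTransGen (H.removeOut x).dir a w) : Relation.ReflTransGen H.dir a w :=
  h.lift id fun _ _ h => h.1

namespace CausalDiagram

variable {V : Type u} [LinearOrder V]

/-- Bayes-ball reachability from the non-action nodes of `S` that come after `x`, through nodes up
to `x`. Colliders must lie in `S` outside `X`; the other nodes must be latent.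
`Link G X S x true w` says that some such path ends in `w` with an arrowhead at `w`;
`Link G X S x false n` says that a path entering `n` by an arrowhead can be continued from `n`
to a node of `S \ X` after `x`. -/
inductive Link (G : CausalDiagram V) (X : Finset V) (S : Set V) (x : V) : Bool → V → Prop
  | late (n : V) : n ∈ S → n ∉ X → x < n → Link G X S x false n
  | collider (n : V) : n ∈ S → n ∉ X → Link G X S x true n → Link G X S x false n
  | up (n m : V) : n ∉ G.observed → G.dir n m → n ≤ x → Link G X S x false m →
      Link G X S x false n
  | bi (w n : V) : Link G X S x false n → G.bi w n → w ≤ x → Link G X S x true w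
  | down (b : Bool) (n w : V) : n ∉ G.observed → Link G X S x b n → G.dir n w → w ≤ x →
      Link G X S x true w

/-- `v` has to be reported truthfully to the target once all nodes of `S` have to be: either `v` is
a parent of a non-action node of `S`, or `v` is an observed non-action, a natural ancestor of an
action `x ∈ S`, and shares a hidden secret with nodes that come after `x`. -/
def Relevant (G : CausalDiagram V) (X : Finset V) (S : Set V) (v : V) : Prop :=
  (∃ n ∈ S, n ∉ X ∧ G.dir v n) ∨
  (v ∈ G.observed ∧ v ∉ X ∧ ∃ x ∈ S, x ∈ X ∧ v < x ∧ Relation.ReflTransGen G.dir v x ∧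
    G.Link X S x true v)

/-- Some action `z` is a natural ancestor of (or equal to) an action `x ∈ S`, and shares a hidden
secret with nodes after `x`. This is the obstruction to imitation. -/
def Exposed (G : CausalDiagram V) (X : Finset V) (S : Set V) : Prop :=
  ∃ z ∈ X, ∃ x ∈ S, x ∈ X ∧ Relation.ReflTransGen G.dir z x ∧ G.Link X S x true z

variable {G : CausalDiagram V} {X : Finset V} {S : Set V}

theorem le_of_reflTransGen {a b : V} (h : Relation.ReflTransGen G.dir a b) : a ≤ b := by
  induction h with
  | refl => exact le_rfl
  | tail _ hbc ih => exact ih.trans (G.dir_lt _ _ hbc).le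

/-- Links beyond `x` are links beyond any earlier node: a node of the path that becomes late
serves as the new end of the path. -/
theorem Link.mono {x x' : V} (hlt : x' ≤ x)
    {b : Bool} {w : V} (h : G.Link X S x b w) (hS : ∀ n, G.Link X S x false n → n ∈ S ∧ n ∉ X) :
    (b = true → w ≤ x' → G.Link X S x' true w) ∧ (b = false → G.Link X S x' false w) := by
  induction h with
  | late n h1 h2 h3 => exact ⟨by simp, fun _ => .late n h1 h2 (hlt.trans_lt h3)⟩
  | collider n h1 h2 _ ih =>
    refine ⟨by simp, fun _ => ?_⟩
    rcases le_or_gt n x' with h | h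
    · exact .collider n h1 h2 (ih.1 rfl h)
    · exact .late n h1 h2 h
  | up n m h1 h2 h3 h4 ih =>
    refine ⟨by simp, fun _ => ?_⟩
    rcases le_or_gt n x' with h | h
    · exact .up n m h1 h2 h (ih.2 rfl)
    · have := hS n (.up n m h1 h2 h3 h4)
      exact .late n this.1 this.2 h
  | bi w n h1 h2 h3 ih => exact ⟨fun _ h => .bi w n (ih.2 rfl) h2 h, by simp⟩
  | down b n w h1 h2 h3 h4 ih =>
    refine ⟨fun _ h => ?_, by simp⟩
    cases b with
    | false => exact .down false n w h1 (ih.2 rfl) h3 h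
    | true => exact .down true n w h1 (ih.1 rfl ((G.dir_lt _ _ h3).le.trans h)) h3 h

/-! ### A closed set without exposed action yields the backdoor criterion -/

section Closed

variable (hX : ∀ x ∈ X, x ∈ G.observed) (hcl : ∀ v, G.Relevant X S v → v ∈ S)
  (hex : ¬ G.Exposed X S)

include hcl in
theorem mem_of_dir {a b : V} (hb : b ∈ S) (hbX : b ∉ X) (hab : G.dir a b) : a ∈ S :=
  hcl a (Or.inl ⟨b, hb, hbX, hab⟩)

include hX hcl in
theorem Link.mem {x w : V} {b : Bool} (h : G.Link X S x b w) : b = false → w ∈ S ∧ w ∉ X := by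
  induction h with
  | late n h1 h2 _ => exact fun _ => ⟨h1, h2⟩
  | collider n h1 h2 _ _ => exact fun _ => ⟨h1, h2⟩
  | up n m h1 h2 _ _ ih =>
    exact fun _ => ⟨mem_of_dir hcl (ih rfl).1 (ih rfl).2 h2, fun h => h1 (hX _ h)⟩
  | bi => simp
  | down => simp

include hX hcl in
theorem Link.true_mono {x x' w : V} (hlt : x' ≤ x) (hw : w ≤ x')
    (h : G.Link X S x true w) : G.Link X S x' true w :=
  (h.mono hlt fun _ hn => Link.mem hX hcl hn rfl).1 rfl hw

include hcl in
/-- A natural ancestor of `S` is in `S`, or one of its natural descendants is an action in `S`. -/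
theorem mem_or_action_of_reflTransGen {a z : V} (h : Relation.ReflTransGen G.dir a z)
    (hz : z ∈ S) :
    a ∈ S ∨ ∃ y ∈ S, y ∈ X ∧ y ≤ z ∧ Relation.ReflTransGen G.dir a y := by
  induction h using Relation.ReflTransGen.head_induction_on with
  | refl => exact Or.inl hz
  | @head a b hab hbz ih =>
    rcases ih with hb | ⟨y, hy, hyX, hyz, hby⟩
    · by_cases hbX : b ∈ X
      · exact Or.inr ⟨b, hb, hbX, le_of_reflTransGen hbz, .single hab⟩
      · exact Or.inl (mem_of_dir hcl hb hbX hab)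
    · exact Or.inr ⟨y, hy, hyX, hyz, .head hab hby⟩

include hX hcl hex in
/-- A linked node with a natural directed path into `S` belongs to `S`: otherwise the first
observed node on that path would be absorbed into `S` or be an exposed action. -/
theorem mem_of_link {x a z : V} (h : Relation.ReflTransGen G.dir a z) (hz : z ∈ S) (hzx : z ≤ x)
    (hl : G.Link X S x true a) : a ∈ S := by
  induction h using Relation.ReflTransGen.head_induction_on with
  | refl => exact hz
  | @head a b hab hbz ih =>
    by_cases haO : a ∈ G.observed
    · rcases mem_or_action_of_reflTransGen hcl (.head hab hbz) hz with h | ⟨y, hy, hyX, hyz, hay⟩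
      · exact h
      · have hl' : G.Link X S y true a :=
          Link.true_mono hX hcl (hyz.trans hzx) (le_of_reflTransGen hay) hl
        by_cases haX : a ∈ X
        · exact (hex ⟨a, haX, y, hy, hyX, hay, hl'⟩).elim
        · refine hcl a (Or.inr ⟨haO, haX, y, hy, hyX, ?_, hay, hl'⟩)
          exact lt_of_le_of_ne (le_of_reflTransGen hay) (fun e => haX (e ▸ hyX))
    · have hbx : b ≤ x := (le_of_reflTransGen hbz).trans hzx
      have hlb : G.Link X S x true b := .down true a b haO hl hab hbx
      have hb := ih hlb
      by_cases hbX : b ∈ X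
      · exact (hex ⟨b, hbX, b, hb, hbX, .refl, Link.true_mono hX hcl hbx le_rfl hlb⟩).elim
      · exact mem_of_dir hcl hb hbX hab

/-- The covariates of an action: everything in `S` that is observed before it. -/
def closureCov (G : CausalDiagram V) (S : Set V) (x : V) : Set V := G.before x ∩ S

theorem manipulated_lt {x a b : V} (h : (G.manipulated X (closureCov G S) x).dir a b) :
    a < b := by
  rcases h with ⟨_, h⟩ | ⟨_, h⟩
  · exact G.dir_lt _ _ h
  · exact h.1.2

include hcl in
theorem manipulated_mem {x a b : V} (h : (G.manipulated X (closureCov G S) x).dir a b)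
    (hb : b ∈ S) (hxb : x < b) : a ∈ S := by
  rcases h with ⟨h1, h⟩ | ⟨_, h⟩
  · exact mem_of_dir hcl hb (fun hbX => h1 ⟨hbX, hxb⟩) h
  · exact h.2

theorem manipulated_natural {x a b : V} (h : (G.manipulated X (closureCov G S) x).dir a b)
    (hb : ¬ (b ∈ X ∧ x < b)) : G.dir a b := by
  rcases h with ⟨_, h⟩ | ⟨h', _⟩
  · exact h
  · exact (hb h').elim

include hcl in
theorem mem_of_manipulated_path {x a w : V}
    (h : Relation.ReflTransGen (G.manipulated X (closureCov G S) x).dir a w) (hw : w ∈ S)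
    (hxa : x ≤ a) : a ∈ S := by
  induction h using Relation.ReflTransGen.head_induction_on with
  | refl => exact hw
  | @head a b hab _ ih =>
    have hlt := manipulated_lt hab
    exact manipulated_mem hcl hab (ih (hxa.trans hlt.le)) (hxa.trans_lt hlt)

theorem natural_of_manipulated_path {x a w : V}
    (h : Relation.ReflTransGen (G.manipulated X (closureCov G S) x).dir a w) (hw : w ≤ x) :
    a ≤ w ∧ Relation.ReflTransGen G.dir a w := by
  induction h using Relation.ReflTransGen.head_induction_on with
  | refl => exact ⟨le_rfl, .refl⟩
  | @head a b hab _ ih =>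
    refine ⟨(manipulated_lt hab).le.trans ih.1, .head ?_ ih.2⟩
    exact manipulated_natural hab fun h => absurd h.2 (not_lt.2 (ih.1.trans hw))

section ActivePath

variable {x Y : V} (hxS : x ∈ S) (hY : Y ∈ S) (hxX : x ∈ X)
  {n : ℕ} {p : ℕ → V} {e : ℕ → EdgeKind}
  (hp0 : p 0 = x) (hpn : p n = Y)
  (hinj : ∀ i j, i ≤ n → j ≤ n → p i = p j → i = j)
  (hjoin : ∀ i, i < n →
    ((G.manipulated X (closureCov G S) x).removeOut x).Joins (e i) (p i) (p (i + 1)))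
  (hcol : ∀ i, i + 1 < n → (e i).headAtTarget → (e (i + 1)).headAtSource →
    p (i + 1) ∈ ((G.manipulated X (closureCov G S) x).removeOut x).An (closureCov G S x))
  (hnon : ∀ i, i < n → ¬ (0 < i ∧ (e (i - 1)).headAtTarget ∧ (e i).headAtSource) →
    p i ∉ closureCov G S x)

include hcl hY hpn hjoin hcol in
/-- From a late node that is left along its arrow, an active path runs down to the target, since
no late node is an ancestor of the covariates. -/
theorem mem_of_late_forward (j : ℕ) : ∀ i, i + j = n → x < p i → (i < n → e i = .forward) →
    p i ∈ S := by
  induction j with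
  | zero =>
    rintro i rfl _ _
    exact hpn ▸ hY
  | succ j ih =>
    intro i hi hx hf
    have hin : i < n := by omega
    have hj := hjoin i hin
    rw [hf hin] at hj
    have hlt : x < p (i + 1) := hx.trans (manipulated_lt hj.1)
    refine manipulated_mem hcl hj.1 (ih (i + 1) (by omega) hlt fun h => ?_) hlt
    by_contra hne
    have hs : (e (i + 1)).headAtSource := EdgeKind.headAtSource_of_ne hne
    obtain ⟨z, hz, hpz⟩ := hcol i h (by rw [hf hin]; trivial) hs
    have := natural_of_manipulated_path (MixedGraph.reflTransGen_of_removeOut hpz) hz.1.2.le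
    exact absurd (hlt.trans_le this.1) (not_lt.2 hz.1.2.le)

variable {d : ℕ} (hdn : d ≤ n) (hd : x < p d) (hbefore : ∀ k, k < d → p k ≤ x)

include hp0 hjoin hcol hxS hdn hbefore in
/-- A node of the early part of an active path that is left backwards towards the action is a
natural ancestor of the action or of its covariates. -/
theorem exists_descendant_of_backward (k : ℕ) (hk : k < d) (he : e k = .backward) :
    ∃ z ∈ S, z ≤ x ∧ Relation.ReflTransGen G.dir (p (k + 1)) z := by
  induction k with
  | zero =>
    have hj := hjoin 0 (by omega)
    rw [he] at hj
    refine ⟨x, hxS, le_rfl, .single ?_⟩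
    have := manipulated_natural hj.1 fun h => absurd h.2 (not_lt.2 (hbefore 0 hk))
    exact hp0 ▸ this
  | succ k ih =>
    have hj := hjoin (k + 1) (by omega)
    rw [he] at hj
    have hnat : G.dir (p (k + 1 + 1)) (p (k + 1)) :=
      manipulated_natural hj.1 fun h => absurd h.2 (not_lt.2 (hbefore _ hk))
    by_cases hb : e k = .backward
    · obtain ⟨z, hz, hzx, h⟩ := ih (by omega) hb
      exact ⟨z, hz, hzx, .head hnat h⟩
    · have ht : (e k).headAtTarget := EdgeKind.headAtTarget_of_ne hb
      obtain ⟨z, hz, hpz⟩ := hcol k (by omega) ht (by rw [he]; trivial)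
      have := natural_of_manipulated_path (MixedGraph.reflTransGen_of_removeOut hpz) hz.1.2.le
      exact ⟨z, hz.2, hz.1.2.le, .head hnat this.2⟩

include hX hcl hex hxS hxX hp0 hinj hjoin hcol hnon hdn hd hbefore in
/-- Walking an active path from its first late node `p d` back to the action, every node is
linked. -/
theorem link_of_active (hdS : p d ∈ S) (j : ℕ) : ∀ k, k + j + 1 = d →
    ((e k).headAtSource → G.Link X S x true (p k)) ∧
    (¬ (e k).headAtSource → G.Link X S x false (p k) ∧ p k ∉ G.observed) := by
  induction j with
  | zero => ?_
  | succ j ih => ?_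
  all_goals
    intro k hk
    have hkn : k < n := by omega
    have hkx : p k ≤ x := hbefore k (by omega)
    have hj := hjoin k hkn
    -- the node after `p k`, when it is entered by an arrowhead
    have hnext : (e k).headAtTarget → G.Link X S x false (p (k + 1)) := ?_
    have hnat : e k = .forward → G.dir (p k) (p (k + 1)) := by
      intro he
      rw [he] at hj
      refine manipulated_natural hj.1 fun h => ?_
      exact (Link.mem hX hcl (hnext (by rw [he]; trivial)) rfl).2 h.1
    have hk0 : e k = .forward → k ≠ 0 := by
      rintro he rfl
      rw [he] at hj
      exact hj.2 hp0
    have hlt : k ≠ 0 → p k < x := fun h0 => lt_of_le_of_ne hkx fun h =>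
      h0 (hinj k 0 (by omega) (by omega) (h.trans hp0.symm))
    have hfwd : e k = .forward → G.Link X S x false (p k) ∧ p k ∉ G.observed := by
      intro he
      have hl := hnext (by rw [he]; trivial)
      have hm := Link.mem hX hcl hl rfl
      have hkS : p k ∈ S := mem_of_dir hcl hm.1 hm.2 (hnat he)
      have hO : p k ∉ G.observed := fun hO =>
        hnon k hkn (by rw [he]; simp [EdgeKind.headAtSource]) ⟨⟨hO, hlt (hk0 he)⟩, hkS⟩
      exact ⟨.up _ _ hO (hnat he) hkx hl, hO⟩
    have hbi : e k = .bidirected → G.Link X S x true (p k) := by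
      intro he
      have hl := hnext (by rw [he]; trivial)
      rw [he] at hj
      refine .bi _ _ hl ?_ hkx
      rcases hj with h | h
      · exact h.1
      · exact G.bi_symm _ _ h.1
    have hbw : e k = .backward → G.Link X S x true (p k) := ?_
    · cases he : e k
      · exact ⟨fun h => h.elim, fun _ => hfwd he⟩
      · exact ⟨fun _ => hbw he, fun h => (h trivial).elim⟩
      · exact ⟨fun _ => hbi he, fun h => (h trivial).elim⟩
  · intro he
    rw [he] at hj
    have := manipulated_lt hj.1
    have hd' : x < p (k + 1) := by convert hd using 2
    exact absurd (hd'.trans this) (not_lt.2 hkx)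
  · intro ht
    have hd' : k + 1 = d := by omega
    rw [hd']
    refine .late _ hdS (fun hdX => ?_) hd
    rw [hd'] at hj
    cases he : e k
    · rw [he] at hj
      rcases hj.1 with h | h
      · exact h.1 ⟨hdX, hd⟩
      · have hk0 : k ≠ 0 := by
          rintro rfl
          exact hj.2 hp0
        have hlt : p k < x := lt_of_le_of_ne hkx fun h =>
          hk0 (hinj k 0 (by omega) (by omega) (h.trans hp0.symm))
        exact hnon k hkn (by rw [he]; simp [EdgeKind.headAtSource]) ⟨⟨h.2.1.1, hlt⟩, h.2.2⟩
    · rw [he] at ht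
      exact ht
    · rw [he] at hj
      rcases hj with h | h
      · exact h.2.2 ⟨hdX, hd⟩
      · exact h.2.1 ⟨hdX, hd⟩
  · intro he
    have hI := ih (k + 1) (by omega)
    have hj' := hj
    rw [he] at hj'
    have hnat : G.dir (p (k + 1)) (p k) :=
      manipulated_natural hj'.1 fun h => absurd h.2 (not_lt.2 hkx)
    by_cases hs : (e (k + 1)).headAtSource
    · have hl := hI.1 hs
      refine .down true _ _ (fun hO => ?_) hl hnat hkx
      obtain ⟨z, hz, hzx, hpz⟩ :=
        exists_descendant_of_backward hxS hp0 hjoin hcol hdn hbefore k (by omega) he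
      have hS := mem_of_link hX hcl hex hpz hz hzx hl
      have hlt : p (k + 1) < x := lt_of_le_of_ne (hbefore _ (by omega)) fun h =>
        absurd (hinj (k + 1) 0 (by omega) (by omega) (h.trans hp0.symm)) (by omega)
      refine hnon (k + 1) (by omega) ?_ ⟨⟨hO, hlt⟩, hS⟩
      rintro ⟨_, h, _⟩
      rw [Nat.add_sub_cancel, he] at h
      exact h
    · have hl := hI.2 hs
      exact .down false _ _ hl.2 hl.1 hnat hkx
  · intro ht
    have hI := ih (k + 1) (by omega)
    by_cases hs : (e (k + 1)).headAtSource
    · have hl := hI.1 hs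
      obtain ⟨z, hz, hpz⟩ := hcol k (by omega) ht hs
      have hpz' := natural_of_manipulated_path (MixedGraph.reflTransGen_of_removeOut hpz) hz.1.2.le
      have hS := mem_of_link hX hcl hex hpz'.2 hz.2 hz.1.2.le hl
      refine .collider _ hS (fun hpX => ?_) hl
      exact hex ⟨_, hpX, _, hS, hpX, .refl,
        Link.true_mono hX hcl (hbefore _ (by omega)) le_rfl hl⟩
    · exact (hI.2 hs).1

end ActivePath

include hX hcl hex in
/-- If `S` contains the target, is closed under relevance and exposes no action, then the
covariates `S ∩ before x` satisfy the sequential π-backdoor criterion: an active path from an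
action to the target would expose that action. -/
theorem isSeqPiBackdoor_closureCov {Y : V} (hY : Y ∈ S) (hYX : Y ∉ X)
    (hle : ∀ s ∈ S, s ≤ Y) : G.IsSeqPiBackdoor X Y (closureCov G S) := by
  refine ⟨fun x _ => Set.inter_subset_left, fun x hxX => ?_⟩
  by_cases hxS : x ∈ S
  · left
    rintro ⟨n, p, e, hp0, hpn, hinj, hjoin, hact⟩
    have hxY : x < Y := lt_of_le_of_ne (hle x hxS) fun h => hYX (h ▸ hxX)
    have hcol : ∀ i, i + 1 < n → (e i).headAtTarget → (e (i + 1)).headAtSource →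
        p (i + 1) ∈ ((G.manipulated X (closureCov G S) x).removeOut x).An (closureCov G S x) :=
      fun i hi h1 h2 => (hact (i + 1) hi.le).1 ⟨by omega, hi, by simpa using h1, h2⟩
    have hnon : ∀ i, i < n → ¬ (0 < i ∧ (e (i - 1)).headAtTarget ∧ (e i).headAtSource) →
        p i ∉ closureCov G S x :=
      fun i hi h => (hact i hi.le).2 fun hc => h ⟨hc.1, hc.2.2⟩
    classical
    have hex' : ∃ i, x < p i := ⟨n, hpn ▸ hxY⟩
    obtain ⟨d, hd, hdn, hbefore⟩ : ∃ d, x < p d ∧ d ≤ n ∧ ∀ k, k < d → p k ≤ x :=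
      ⟨Nat.find hex', Nat.find_spec hex', Nat.find_min' hex' (hpn ▸ hxY),
        fun k hk => not_lt.1 (Nat.find_min hex' hk)⟩
    have hd0 : d ≠ 0 := by
      intro h
      rw [h, hp0] at hd
      exact lt_irrefl _ hd
    have hdS : p d ∈ S := by
      refine mem_of_late_forward hcl hY hpn hjoin hcol (n - d) d (by omega) hd fun hlt => ?_
      by_contra hne
      have hs : (e d).headAtSource := EdgeKind.headAtSource_of_ne hne
      obtain ⟨k, hk⟩ := Nat.exists_eq_succ_of_ne_zero hd0
      rw [Nat.succ_eq_add_one] at hk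
      have ht : (e k).headAtTarget := by
        have hj := hjoin k (by omega)
        cases he : e k
        · trivial
        · rw [he, ← hk] at hj
          exact absurd (hd.trans (manipulated_lt hj.1)) (not_lt.2 (hbefore k (by omega)))
        · trivial
      rw [hk] at hs hlt
      obtain ⟨z, hz, hpz⟩ := hcol k hlt ht hs
      have := natural_of_manipulated_path (MixedGraph.reflTransGen_of_removeOut hpz) hz.1.2.le
      rw [hk] at hd
      exact absurd (hd.trans_le this.1) (not_lt.2 hz.1.2.le)
    have hI := link_of_active hX hcl hex hxS hxX hp0 hinj hjoin hcol hnon hdn hd hbefore hdS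
      (d - 1) 0 (by omega)
    have hj := hjoin 0 (by omega)
    have hs : (e 0).headAtSource := by
      cases he : e 0
      · rw [he] at hj
        exact (hj.2 hp0).elim
      · trivial
      · trivial
    exact hex ⟨x, hxX, x, hxS, hxX, .refl, hp0 ▸ hI.1 hs⟩
  · right
    rintro ⟨w, rfl, h⟩
    exact hxS (mem_of_manipulated_path hcl h hY le_rfl)

end Closed

end CausalDiagram

/-! ### Secrets shared along a hidden path -/

namespace CausalDiagram

variable {V : Type u} [LinearOrder V]

/-- The explicit path behind `Link G X S x true z`: it starts in `z` with an arrowhead at `z`, stays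
up to `x`, and ends in a node of `S \ X` after `x`. Inner colliders lie in `S \ X`, other inner
nodes are latent. Nodes may be repeated. -/
structure HiddenPath (G : CausalDiagram V) (X : Finset V) (S : Set V) (x z : V) where
  len : ℕ
  node : ℕ → V
  edge : ℕ → EdgeKind
  node_zero : node 0 = z
  joins : ∀ k < len, G.Joins (edge k) (node k) (node (k + 1))
  node_le : ∀ k < len, node k ≤ x
  last_mem : node len ∈ S
  last_notMem : node len ∉ X
  lt_last : x < node len
  collider : ∀ k, k + 1 < len → (edge k).headAtTarget → (edge (k + 1)).headAtSource →
    node (k + 1) ∈ S ∧ node (k + 1) ∉ X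
  latent : ∀ k, k + 1 < len → ¬ ((edge k).headAtTarget ∧ (edge (k + 1)).headAtSource) →
    node (k + 1) ∉ G.observed
  len_pos : 0 < len
  head : (edge 0).headAtSource

variable {G : CausalDiagram V} {X : Finset V} {S : Set V} {x z : V}

/-- A path from `n` to a late node as in `HiddenPath`, without any condition on the first node. -/
def HasHiddenPath (G : CausalDiagram V) (X : Finset V) (S : Set V) (x n : V)
    (start : ℕ → EdgeKind → Prop) : Prop :=
  ∃ (r : ℕ) (p : ℕ → V) (e : ℕ → EdgeKind), p 0 = n ∧
    (∀ k < r, G.Joins (e k) (p k) (p (k + 1))) ∧ (∀ k < r, p k ≤ x) ∧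
    (p r ∈ S ∧ p r ∉ X ∧ x < p r) ∧
    (∀ k, k + 1 < r → (e k).headAtTarget → (e (k + 1)).headAtSource →
      p (k + 1) ∈ S ∧ p (k + 1) ∉ X) ∧
    (∀ k, k + 1 < r → ¬ ((e k).headAtTarget ∧ (e (k + 1)).headAtSource) →
      p (k + 1) ∉ G.observed) ∧ start r (e 0)

theorem HasHiddenPath.cons {n w : V} {st st' : ℕ → EdgeKind → Prop} {e₀ : EdgeKind}
    (h : HasHiddenPath G X S x n st) (hj : G.Joins e₀ w n) (hw : w ≤ x)
    (hst : ∀ r e, st r e → 0 < r →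
      (e₀.headAtTarget → e.headAtSource → n ∈ S ∧ n ∉ X) ∧
      (¬ (e₀.headAtTarget ∧ e.headAtSource) → n ∉ G.observed))
    (hst' : ∀ r, 0 < r → st' r e₀) : HasHiddenPath G X S x w st' := by
  obtain ⟨r, p, e, h0, h1, h2, h3, h4, h5, h6⟩ := h
  refine ⟨r + 1, fun k => Nat.casesOn k w p, fun k => Nat.casesOn k e₀ e, rfl, ?_, ?_, h3,
    ?_, ?_, hst' _ (by omega)⟩
  · rintro (_ | k) hk
    · simpa [h0] using hj
    · exact h1 k (by omega)
  · rintro (_ | k) hk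
    · exact hw
    · exact h2 k (by omega)
  · rintro (_ | k) hk
    · simpa [h0] using (hst r _ h6 (by omega)).1
    · exact h4 k (by omega)
  · rintro (_ | k) hk
    · simpa [h0] using (hst r _ h6 (by omega)).2
    · exact h5 k (by omega)

theorem Link.hasHiddenPath {b : Bool} {w : V} (h : G.Link X S x b w) :
    HasHiddenPath G X S x w fun r e =>
      (b = true → 0 < r ∧ e.headAtSource) ∧
      (b = false → 0 < r → (e.headAtSource → w ∈ S ∧ w ∉ X) ∧
        (¬ e.headAtSource → w ∉ G.observed)) ∧ (w ≤ x → 0 < r) := by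
  induction h with
  | late n h1 h2 h3 =>
    exact ⟨0, fun _ => n, fun _ => .forward, rfl, by simp, by simp, ⟨h1, h2, h3⟩, by simp, by simp,
      by simp, by simp, fun h => absurd h3 (not_lt.2 h)⟩
  | collider n h1 h2 _ ih =>
    obtain ⟨r, p, e, h⟩ := ih
    refine ⟨r, p, e, h.1, h.2.1, h.2.2.1, h.2.2.2.1, h.2.2.2.2.1, h.2.2.2.2.2.1, by simp,
      fun _ _ => ⟨fun _ => ⟨h1, h2⟩, fun h' => ?_⟩, h.2.2.2.2.2.2.2.2⟩
    exact (h' (h.2.2.2.2.2.2.1 rfl).2).elim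
  | up n m h1 h2 h3 _ ih =>
    refine ih.cons (e₀ := .forward) h2 h3 (fun r e h hr => ?_) fun r hr => ?_
    · have := h.2.1 rfl hr
      exact ⟨fun _ => this.1, fun h' => this.2 fun h'' => h' ⟨trivial, h''⟩⟩
    · exact ⟨by simp, fun _ _ => ⟨fun h => h.elim, fun _ => h1⟩, fun _ => hr⟩
  | bi w n _ h2 h3 ih =>
    refine ih.cons (e₀ := .bidirected) (Or.inr (G.bi_symm _ _ h2)) h3 (fun r e h hr => ?_)
      fun r hr => ?_
    · have := h.2.1 rfl hr
      exact ⟨fun _ => this.1, fun h' => this.2 fun h'' => h' ⟨trivial, h''⟩⟩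
    · exact ⟨fun _ => ⟨hr, trivial⟩, by simp, fun _ => hr⟩
  | down b n w h1 _ h3 h4 ih =>
    refine ih.cons (e₀ := .backward) h3 h4 (fun r e h hr => ?_) fun r hr => ?_
    · exact ⟨fun h => h.elim, fun _ => h1⟩
    · exact ⟨fun _ => ⟨hr, trivial⟩, by simp, fun _ => hr⟩

theorem Link.nonempty_hiddenPath (h : G.Link X S x true z) :
    Nonempty (HiddenPath G X S x z) := by
  obtain ⟨r, p, e, h0, h1, h2, h3, h4, h5, h6⟩ := h.hasHiddenPath
  exact ⟨⟨r, p, e, h0, h1, h2, h3.1, h3.2.1, h3.2.2, h4, h5, (h6.1 rfl).1, (h6.1 rfl).2⟩⟩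

theorem exists_path_of_reflTransGen {a b : V} (h : Relation.ReflTransGen G.dir a b) :
    ∃ (m : ℕ) (q : ℕ → V), q 0 = a ∧ q m = b ∧ ∀ k < m, G.dir (q k) (q (k + 1)) := by
  induction h using Relation.ReflTransGen.head_induction_on with
  | refl => exact ⟨0, fun _ => b, rfl, rfl, by simp⟩
  | @head a c hac _ ih =>
    obtain ⟨m, q, h0, hm, hq⟩ := ih
    refine ⟨m + 1, fun k => Nat.casesOn k a q, rfl, hm, ?_⟩
    rintro (_ | k) hk
    · simpa [h0] using hac
    · exact hq k (by omega)

/-- The exogenous variables of the models are indexed by pairs of nodes: `(i, i)` is private to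
`i`, and `(a, b)` with `a ≠ b` is an argument of `a` and `b` when they are confounded. -/
def sites (G : CausalDiagram V) (i : V) : Set (V × V) :=
  {s | (s.1 = i ∨ s.2 = i) ∧ (s.1 = s.2 ∨ G.bi s.1 s.2)}

theorem mem_sites_of_joins {a b : V} (h : G.Joins .bidirected a b) :
    (a, b) ∈ G.sites a ∧ (a, b) ∈ G.sites b := by
  have : G.bi a b := h.elim id (G.bi_symm _ _)
  exact ⟨⟨Or.inl rfl, Or.inr this⟩, ⟨Or.inr rfl, Or.inr this⟩⟩

namespace HiddenPath

variable (T : HiddenPath G X S x z) {K : Type*} [AddCommGroup K]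

/-- The `κ`-th node displays the sum of the secrets of its two edges (a collider), or the secret
of its only edge (the last node). -/
def Displays (κ : ℕ) : Prop :=
  (T.edge (κ - 1)).headAtTarget ∧ (κ = T.len ∨ (T.edge κ).headAtSource)

/-- The secret carried by the `k`-th edge. It is exogenous on a bi-directed edge; otherwise it is
what the tail of the edge holds on its hidden track. There is no secret after the last node. -/
def secret (hid : V → ℕ → K) (ω : V × V → ℕ → K) (k : ℕ) : K :=
  if k < T.len then
    match T.edge k with
    | .forward => hid (T.node k) k
    | .backward => hid (T.node (k + 1)) (k + 1)
    | .bidirected => ω (T.node k, T.node (k + 1)) k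
  else 0

open Classical in
/-- What `i` holds on its hidden track `κ`: if `i` is the `κ`-th node and an inner non-collider,
the secret of the edge with an arrowhead at `i`, or a private secret if `i` is a fork. -/
noncomputable def hiddenTrack (hid : V → ℕ → K) (ω : V × V → ℕ → K) (i : V) (κ : ℕ) : K :=
  if T.node κ = i ∧ 0 < κ ∧ κ < T.len ∧ ¬ T.Displays κ then
    if (T.edge (κ - 1)).headAtTarget then T.secret hid ω (κ - 1)
    else if (T.edge κ).headAtSource then T.secret hid ω κ
    else ω (i, i) κ
  else 0

open Classical in
/-- What `i` displays as the `κ`-th node. -/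
noncomputable def displayTrack (hid : V → ℕ → K) (ω : V × V → ℕ → K) (i : V) (κ : ℕ) : K :=
  if T.node κ = i ∧ 0 < κ ∧ κ ≤ T.len ∧ T.Displays κ then
    T.secret hid ω (κ - 1) + T.secret hid ω κ
  else 0

variable {T}

theorem lt_last_of_lt {k : ℕ} (hk : k < T.len) : T.node k < T.node T.len :=
  (T.node_le k hk).trans_lt T.lt_last

theorem headAtTarget_last : (T.edge (T.len - 1)).headAtTarget := by
  refine EdgeKind.headAtTarget_of_ne fun h => ?_
  have hpos := T.len_pos
  have hj := T.joins (T.len - 1) (by omega)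
  rw [h, Nat.sub_add_cancel hpos] at hj
  exact absurd (G.dir_lt _ _ hj) (not_lt.2 (lt_last_of_lt (by omega)).le)

theorem displays_last : T.Displays T.len := ⟨headAtTarget_last, Or.inl rfl⟩

theorem Displays.mem {κ : ℕ} (h : T.Displays κ) (h0 : 0 < κ) (hκ : κ ≤ T.len) :
    T.node κ ∈ S ∧ T.node κ ∉ X := by
  rcases hκ.eq_or_lt with rfl | hlt
  · exact ⟨T.last_mem, T.last_notMem⟩
  · obtain ⟨k, rfl⟩ := Nat.exists_eq_succ_of_ne_zero h0.ne'
    exact T.collider k hlt h.1 (h.2.resolve_left hlt.ne)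

theorem notMem_observed_of_not_displays {κ : ℕ} (h : ¬ T.Displays κ) (h0 : 0 < κ)
    (hκ : κ < T.len) : T.node κ ∉ G.observed := by
  obtain ⟨k, rfl⟩ := Nat.exists_eq_succ_of_ne_zero h0.ne'
  exact T.latent k hκ fun h' => h ⟨h'.1, Or.inr h'.2⟩

/-- The secret of an edge with an arrowhead at its second node is determined by what that node can
see. -/
theorem secret_congr_target {hid hid' : V → ℕ → K} {ω ω' : V × V → ℕ → K} {k : ℕ}
    (hk : k < T.len) (ht : (T.edge k).headAtTarget)
    (hhid : ∀ w, G.dir w (T.node (k + 1)) → hid w = hid' w)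
    (hω : ∀ s ∈ G.sites (T.node (k + 1)), ω s = ω' s) :
    T.secret hid ω k = T.secret hid' ω' k := by
  have hj := T.joins k hk
  unfold secret
  cases he : T.edge k <;> rw [he] at hj ht
  · simp [hhid _ hj]
  · exact ht.elim
  · simp [hω _ (mem_sites_of_joins hj).2]

/-- The secret of an edge with an arrowhead at its first node is determined by what that node can
see. -/
theorem secret_congr_source {hid hid' : V → ℕ → K} {ω ω' : V × V → ℕ → K} {k : ℕ}
    (hs : k < T.len → (T.edge k).headAtSource)
    (hhid : ∀ w, G.dir w (T.node k) → hid w = hid' w)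
    (hω : ∀ s ∈ G.sites (T.node k), ω s = ω' s) :
    T.secret hid ω k = T.secret hid' ω' k := by
  unfold secret
  by_cases hk : k < T.len
  · have hj := T.joins k hk
    have hs := hs hk
    cases he : T.edge k <;> rw [he] at hj hs
    · exact hs.elim
    · simp [hhid _ hj]
    · simp [hω _ (mem_sites_of_joins hj).1]
  · simp [hk]

theorem hiddenTrack_congr {hid hid' : V → ℕ → K} {ω ω' : V × V → ℕ → K} {i : V}
    (hhid : ∀ w, G.dir w i → hid w = hid' w) (hω : ∀ s ∈ G.sites i, ω s = ω' s) (κ : ℕ) :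
    T.hiddenTrack hid ω i κ = T.hiddenTrack hid' ω' i κ := by
  unfold hiddenTrack
  split_ifs with h1 h2 h3
  · obtain ⟨rfl, h0, hκ, -⟩ := h1
    obtain ⟨k, rfl⟩ := Nat.exists_eq_succ_of_ne_zero h0.ne'
    exact secret_congr_target (by omega) h2 hhid hω
  · obtain ⟨rfl, h0, hκ, -⟩ := h1
    exact secret_congr_source (fun _ => h3) hhid hω
  · rw [hω (i, i) ⟨Or.inl rfl, Or.inl rfl⟩]
  · rfl

theorem displayTrack_congr {hid hid' : V → ℕ → K} {ω ω' : V × V → ℕ → K} {i : V}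
    (hhid : ∀ w, G.dir w i → hid w = hid' w) (hω : ∀ s ∈ G.sites i, ω s = ω' s) (κ : ℕ) :
    T.displayTrack hid ω i κ = T.displayTrack hid' ω' i κ := by
  unfold displayTrack
  split_ifs with h1
  · obtain ⟨rfl, h0, hκ, hd⟩ := h1
    congr 1
    · obtain ⟨k, rfl⟩ := Nat.exists_eq_succ_of_ne_zero h0.ne'
      exact secret_congr_target (by omega) hd.1 hhid hω
    · exact secret_congr_source (fun h => hd.2.resolve_left h.ne) hhid hω
  · rfl

section Shift

variable {hid hid' : V → ℕ → K} {ω ω' : V × V → ℕ → K} {δ : K}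
  (hω : ∀ s k, ω' s k = ω s k + δ)

include hω

theorem secret_shift {k : ℕ} (hk : k < T.len) (hhead : k = 0 → (T.edge k).headAtSource)
    {i : V} (hi : (T.edge k).headAtTarget ∧ i = T.node (k + 1) ∨
      (T.edge k).headAtSource ∧ i = T.node k)
    (hhid : ∀ κ, 0 < κ → κ < T.len → ¬ T.Displays κ → T.node κ < i →
      hid' (T.node κ) κ = hid (T.node κ) κ + δ) :
    T.secret hid' ω' k = T.secret hid ω k + δ := by
  have hj := T.joins k hk
  unfold secret
  cases he : T.edge k <;> rw [he] at hj hhead hi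
  · have h0 : 0 < k := Nat.pos_of_ne_zero fun h => hhead h
    obtain ⟨-, rfl⟩ := hi.resolve_right fun h => h.1
    simp only [hk, if_true]
    refine hhid k h0 hk (fun hd => ?_) (G.dir_lt _ _ hj)
    have := hd.2.resolve_left hk.ne
    rw [he] at this
    exact this
  · obtain ⟨-, rfl⟩ := hi.resolve_left fun h => h.1
    simp only [hk, if_true]
    have hk1 : k + 1 ≠ T.len := by
      intro h
      have := headAtTarget_last (T := T)
      rw [← h, Nat.add_sub_cancel, he] at this
      exact this
    refine hhid (k + 1) (by omega) (by omega) (fun hd => ?_) (G.dir_lt _ _ hj)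
    have := hd.1
    rw [Nat.add_sub_cancel, he] at this
    exact this
  · simp only [hk, if_true, hω]

/-- If all exogenous secrets are shifted by `δ`, then so is every hidden track. -/
theorem hiddenTrack_shift {i : V} (hhid : ∀ κ, 0 < κ → κ < T.len → ¬ T.Displays κ →
      T.node κ < i → hid' (T.node κ) κ = hid (T.node κ) κ + δ)
    {κ : ℕ} (hκi : T.node κ = i) (h0 : 0 < κ) (hκ : κ < T.len) (hd : ¬ T.Displays κ) :
    T.hiddenTrack hid' ω' i κ = T.hiddenTrack hid ω i κ + δ := by
  have hc : T.node κ = i ∧ 0 < κ ∧ κ < T.len ∧ ¬ T.Displays κ := ⟨hκi, h0, hκ, hd⟩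
  unfold hiddenTrack
  rw [if_pos hc, if_pos hc]
  obtain ⟨k, rfl⟩ := Nat.exists_eq_succ_of_ne_zero h0.ne'
  split_ifs with h1 h2
  · exact secret_shift hω (by simpa using (by omega : k < T.len))
      (fun h => by rw [h]; exact T.head) (Or.inl ⟨h1, hκi.symm⟩) hhid
  · exact secret_shift hω hκ (by simp) (Or.inr ⟨h2, hκi.symm⟩) hhid
  · exact hω _ _

/-- A collider receives the shift twice, so that its display does not change. -/
theorem displayTrack_shift (h2 : δ + δ = 0) {i : V}
    (hhid : ∀ κ, 0 < κ → κ < T.len → ¬ T.Displays κ →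
      T.node κ < i → hid' (T.node κ) κ = hid (T.node κ) κ + δ)
    (hi : i < T.node T.len) (κ : ℕ) :
    T.displayTrack hid' ω' i κ = T.displayTrack hid ω i κ := by
  unfold displayTrack
  split_ifs with h
  · obtain ⟨hκi, h0, hκ, hd⟩ := h
    have hlt : κ < T.len := lt_of_le_of_ne hκ fun h => by
      rw [← hκi, h] at hi
      exact lt_irrefl _ hi
    have hs := hd.2.resolve_left hlt.ne
    have ht := hd.1
    obtain ⟨k, rfl⟩ := Nat.exists_eq_succ_of_ne_zero h0.ne'
    rw [secret_shift hω hlt (by simp) (Or.inr ⟨hs, hκi.symm⟩) hhid,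
      secret_shift hω (by simpa using (by omega : k < T.len))
        (fun h => by rw [h]; exact T.head) (Or.inl ⟨ht, hκi.symm⟩) hhid,
      add_add_add_comm, h2, add_zero]
  · rfl

theorem secret_zero_shift (hhid : ∀ κ, 0 < κ → κ < T.len → ¬ T.Displays κ →
      T.node κ < z → hid' (T.node κ) κ = hid (T.node κ) κ + δ) :
    T.secret hid' ω' 0 = T.secret hid ω 0 + δ :=
  secret_shift hω T.len_pos (fun _ => T.head) (Or.inr ⟨T.head, T.node_zero.symm⟩) hhid

end Shift

open Classical in
/-- The displays add up to the secret that the first node receives: all other secrets occur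
twice. -/
theorem secret_zero_eq_sum (h2 : ∀ a : K, a + a = 0) {hid : V → ℕ → K} {ω : V × V → ℕ → K}
    (hhid : ∀ κ, 0 < κ → κ < T.len → ¬ T.Displays κ →
      hid (T.node κ) κ = T.hiddenTrack hid ω (T.node κ) κ) :
    T.secret hid ω 0 = ∑ k ∈ Finset.range T.len,
      if T.Displays (k + 1) then T.displayTrack hid ω (T.node (k + 1)) (k + 1) else 0 := by
  suffices h : ∀ j ≤ T.len, T.secret hid ω 0 = (∑ k ∈ Finset.range j,
      if T.Displays (k + 1) then T.displayTrack hid ω (T.node (k + 1)) (k + 1) else 0) +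
      T.secret hid ω j by
    rw [h T.len le_rfl]
    simp [secret]
  intro j
  induction j with
  | zero => simp
  | succ j ih =>
    intro hj
    rw [ih (by omega), Finset.sum_range_succ, add_assoc]
    congr 1
    split_ifs with hd
    · rw [displayTrack, if_pos ⟨rfl, by omega, hj, hd⟩, Nat.add_sub_cancel, add_assoc, h2,
        add_zero]
    · have hlt : j + 1 < T.len := lt_of_le_of_ne hj fun h => hd (h ▸ displays_last)
      have hh := hhid (j + 1) (by omega) hlt hd
      rw [hiddenTrack, if_pos ⟨rfl, by omega, hlt, hd⟩, Nat.add_sub_cancel] at hh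
      rw [zero_add]
      have hj' : j < T.len := by omega
      split_ifs at hh with h3 h4
      · -- the secret comes in along edge `j` and goes out along edge `j + 1`
        have he : T.edge (j + 1) = .forward := by
          by_contra hne
          exact hd ⟨h3, Or.inr (EdgeKind.headAtSource_of_ne hne)⟩
        rw [← hh]
        simp [secret, hlt, he]
      · have he : T.edge j = .backward := by
          by_contra hne
          exact h3 (EdgeKind.headAtTarget_of_ne hne)
        rw [← hh]
        simp [secret, hj', he]
      · have he : T.edge j = .backward := by
          by_contra hne
          exact h3 (EdgeKind.headAtTarget_of_ne hne)
        have he' : T.edge (j + 1) = .forward := by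
          by_contra hne
          exact h4 (EdgeKind.headAtSource_of_ne hne)
        simp [secret, hj', hlt, he, he']

end HiddenPath

end CausalDiagram

/-! ### Games -/

namespace CausalDiagram

variable {V : Type u} [LinearOrder V]

/-- A deterministic model with uniform exogenous noise, together with a test on the public values
of the nodes that always succeeds when all nodes follow their mechanisms. The value of a node
consists of a public part, which the actions are allowed to see even when the node is latent, and
of a hidden part, which carries no information at observed nodes. -/
structure Game (G : CausalDiagram V) where
  Pub : Type
  Hid : Type
  Noise : Type
  finite_pub : Finite Pub
  finite_hid : Finite Hid
  finite_noise : Finite Noise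
  nonempty_pub : Nonempty Pub
  nonempty_hid : Nonempty Hid
  nonempty_noise : Nonempty Noise
  mech : V → (V → Pub × Hid) → (V × V → Noise) → Pub × Hid
  mech_congr : ∀ i v v' ω ω', (∀ w, G.dir w i → v w = v' w) → (∀ s ∈ G.sites i, ω s = ω' s) →
    mech i v ω = mech i v' ω'
  hid_observed : ∀ i ∈ G.observed, ∃ h, ∀ v ω, (mech i v ω).2 = h
  test : (V → Pub) → Prop
  test_natural : ∀ v ω, (∀ i, v i = mech i v ω) → test fun i => (v i).1

attribute [instance] Game.finite_pub Game.finite_hid Game.finite_noise Game.nonempty_pub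
  Game.nonempty_hid Game.nonempty_noise

/-- A play of the actions `X`, given by the resulting values for each value of the noise: the
other nodes follow their mechanisms, and an action is a function of the public values of the
earlier nodes. -/
def Game.IsPlay {G : CausalDiagram V} (𝒢 : G.Game) (X : Finset V)
    (ρ : (V × V → 𝒢.Noise) → V → 𝒢.Pub × 𝒢.Hid) : Prop :=
  (∀ ω, ∀ i ∉ X, ρ ω i = 𝒢.mech i (ρ ω) ω) ∧
  ∀ ω ω', ∀ i ∈ X, (∀ w < i, (ρ ω w).1 = (ρ ω' w).1) → ρ ω i = ρ ω' i

/-- Some game whose test reads only the nodes in `S` cannot be passed with certainty. -/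
def Hard (G : CausalDiagram V) (X : Finset V) (S : Set V) : Prop :=
  ∃ 𝒢 : G.Game, (∀ p p', (∀ s ∈ S, p s = p' s) → 𝒢.test p → 𝒢.test p') ∧
    ∀ ρ, 𝒢.IsPlay X ρ → ∃ ω, ¬ 𝒢.test fun i => (ρ ω i).1

variable {G : CausalDiagram V} {X : Finset V} {S : Set V} {x z : V}

namespace Game

/-- The game in which nothing happens. -/
def trivialGame (G : CausalDiagram V) : G.Game where
  Pub := Unit
  Hid := Unit
  Noise := Unit
  finite_pub := inferInstance
  finite_hid := inferInstance
  finite_noise := inferInstance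
  nonempty_pub := inferInstance
  nonempty_hid := inferInstance
  nonempty_noise := inferInstance
  mech _ _ _ := ((), ())
  mech_congr _ _ _ _ _ _ _ := rfl
  hid_observed _ _ := ⟨(), fun _ _ => rfl⟩
  test _ := True
  test_natural _ _ _ := trivial

/-! ### Reporting a parent -/

open Classical in
/-- The game in which `n` publishes a copy of the public value of its parent `a`, and the test
reads this copy in place of the value of `a`. -/
noncomputable def report (𝒢 : G.Game) {a n : V} (han : G.dir a n) : G.Game where
  Pub := 𝒢.Pub × 𝒢.Pub
  Hid := 𝒢.Hid
  Noise := 𝒢.Noise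
  finite_pub := inferInstance
  finite_hid := inferInstance
  finite_noise := inferInstance
  nonempty_pub := inferInstance
  nonempty_hid := inferInstance
  nonempty_noise := inferInstance
  mech i v ω :=
    let o := 𝒢.mech i (fun w => ((v w).1.1, (v w).2)) ω
    ((o.1, if i = n then (v a).1.1 else o.1), o.2)
  mech_congr i v v' ω ω' hv hω := by
    have h := 𝒢.mech_congr i (fun w => ((v w).1.1, (v w).2)) (fun w => ((v' w).1.1, (v' w).2))
      ω ω' (fun w hw => by simp [hv w hw]) hω
    simp only [h]
    split_ifs with hi
    · subst hi
      rw [hv a han]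
    · rfl
  hid_observed i hi := by
    obtain ⟨h, hh⟩ := 𝒢.hid_observed i hi
    exact ⟨h, fun v ω => hh _ _⟩
  test p := 𝒢.test (Function.update (fun i => (p i).1) a (p n).2)
  test_natural v ω hv := by
    have h := 𝒢.test_natural (fun w => ((v w).1.1, (v w).2)) ω fun i => by
      conv_lhs => rw [hv i]
    have hn : (v n).1.2 = (v a).1.1 := by
      conv_lhs => rw [hv n]
      simp
    rw [hn, Function.update_eq_self_iff.2 rfl]
    exact h

end Game

theorem Hard.of_parent [Finite V] {a n : V} (hn : n ∈ S) (hnX : n ∉ X) (han : G.dir a n)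
    (h : G.Hard X (insert a S)) : G.Hard X S := by
  classical
  obtain ⟨𝒢, hS, hard⟩ := h
  refine ⟨𝒢.report han, fun p p' hp => hS _ _ fun s hs => ?_, fun ρ hρ => ?_⟩
  · by_cases hsa : s = a
    · subst hsa
      simp [hp n hn]
    · simp [hsa, hp s (hs.resolve_left hsa)]
  · suffices hplay : 𝒢.IsPlay X fun ω i => ((ρ ω i).1.1, (ρ ω i).2) by
      obtain ⟨ω, hω⟩ := hard _ hplay
      refine ⟨ω, fun ht => hω ?_⟩
      have hn : (ρ ω n).1.2 = (ρ ω a).1.1 := by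
        conv_lhs => rw [hρ.1 ω n hnX]
        simp [Game.report]
      change 𝒢.test (Function.update (fun i => (ρ ω i).1.1) a (ρ ω n).1.2) at ht
      rw [hn, Function.update_eq_self_iff.2 rfl] at ht
      exact ht
    refine ⟨fun ω i hi => ?_, ?_⟩
    · exact congrArg (fun o => (o.1.1, o.2)) (hρ.1 ω i hi)
    · intro ω ω' i hi hpast
      suffices h : ∀ w, w < i → (ρ ω w).1 = (ρ ω' w).1 from
        congrArg (fun o => (o.1.1, o.2)) (hρ.2 ω ω' i hi h)
      intro w
      induction w using WellFoundedLT.induction with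
      | ind w ih =>
        intro hw
        by_cases hwX : w ∈ X
        · rw [hρ.2 ω ω' w hwX fun y hy => ih y hy (hy.trans hw)]
        · have hm := hρ.1 ω w hwX
          have hm' := hρ.1 ω' w hwX
          refine Prod.ext (hpast w hw) ?_
          have h1 : (ρ ω w).1.1 = (ρ ω' w).1.1 := hpast w hw
          by_cases hwn : w = n
          · subst hwn
            rw [hm, hm']
            simpa [Game.report] using hpast a ((G.dir_lt _ _ han).trans hw)
          · rw [hm, hm'] at h1 ⊢
            simpa [Game.report, hwn] using h1

/-! ### Certifying an ancestor of an action by a shared secret -/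

namespace HiddenPath

variable (T : HiddenPath G X S x z)

/-- The number `k ≤ m` as an index of a track (larger numbers are reduced modulo `m + 1`). -/
def pos (_ : HiddenPath G X S x z) (m k : ℕ) : Fin (m + 1) := Fin.ofNat (m + 1) k

theorem val_pos {m k : ℕ} (hk : k ≤ m) : (T.pos m k : ℕ) = k :=
  Nat.mod_eq_of_lt (Nat.lt_succ_of_le hk)

end HiddenPath

namespace Game

variable (𝒢 : G.Game) (T : HiddenPath G X S x z) {m : ℕ} {q : ℕ → V}

/-- The public values of the game `certify`: a value of the given game, claims about the message
of `z` with its tag on their way to `x`, and the displays along the hidden path. -/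
abbrev CertPub (m : ℕ) : Type :=
  𝒢.Pub × (Fin (m + 1) → 𝒢.Pub × ZMod 2) × (Fin (T.len + 1) → 𝒢.Pub → ZMod 2)

/-- The hidden values of the game `certify`: a secret is a function `Pub → ZMod 2`. -/
abbrev CertHid : Type := 𝒢.Hid × (Fin (T.len + 1) → 𝒢.Pub → ZMod 2)

/-- The noise of the game `certify`. -/
abbrev CertNoise : Type := 𝒢.Noise × (Fin (T.len + 1) → 𝒢.Pub → ZMod 2)

variable {𝒢 T}

/-- Forgetting the certificates. -/
def base (v : V → 𝒢.CertPub T m × 𝒢.CertHid T) (w : V) : 𝒢.Pub × 𝒢.Hid :=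
  ((v w).1.1, (v w).2.1)

/-- The hidden tracks of all nodes. -/
def hid (v : V → 𝒢.CertPub T m × 𝒢.CertHid T) (w : V) (k : ℕ) : 𝒢.Pub → ZMod 2 :=
  (v w).2.2 (T.pos T.len k)

/-- The exogenous secrets. -/
def exo (ω : V × V → 𝒢.CertNoise T) (s : V × V) (k : ℕ) : 𝒢.Pub → ZMod 2 :=
  (ω s).2 (T.pos T.len k)

open Classical in
/-- The mechanisms of the game `certify`. The node `z = q 0` tags its public value `b` with the
value at `b` of the secret function that it receives, and the pair travels along the directed path
`q` to `x = q m`. -/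
noncomputable def certMech (q : ℕ → V) (i : V) (v : V → 𝒢.CertPub T m × 𝒢.CertHid T)
    (ω : V × V → 𝒢.CertNoise T) : 𝒢.CertPub T m × 𝒢.CertHid T :=
  let o := 𝒢.mech i (base v) fun s => (ω s).1
  ((o.1,
    fun μ => if q μ = i then
        if (μ : ℕ) = 0 then (o.1, T.secret (hid v) (exo ω) 0 o.1)
        else (v (q (μ - 1))).1.2.1 (T.pos m (μ - 1))
      else Classical.arbitrary _,
    fun κ => T.displayTrack (hid v) (exo ω) i κ),
   o.2, fun κ => T.hiddenTrack (hid v) (exo ω) i κ)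

open Classical in
/-- The displays yield the secret function received by `z`, as read off from the public values. -/
noncomputable def revealed (p : V → 𝒢.CertPub T m) : 𝒢.Pub → ZMod 2 :=
  ∑ k ∈ Finset.range T.len,
    if T.Displays (k + 1) then (p (T.node (k + 1))).2.2 (T.pos T.len (k + 1)) else 0

/-- The claim about `z` that arrives at `x = q m`. -/
def claim (q : ℕ → V) (p : V → 𝒢.CertPub T m) : 𝒢.Pub × ZMod 2 := (p (q m)).2.1 (T.pos m m)

section Natural

variable {v : V → 𝒢.CertPub T m × 𝒢.CertHid T} {ω : V × V → 𝒢.CertNoise T}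

theorem secret_eq_revealed (hX : ∀ x ∈ X, x ∈ G.observed)
    (hv : ∀ i ∉ X, v i = certMech q i v ω) :
    T.secret (hid v) (exo ω) 0 = revealed fun i => (v i).1 := by
  rw [HiddenPath.secret_zero_eq_sum fun a => CharTwo.add_self_eq_zero a]
  · refine Finset.sum_congr rfl fun k hk => ?_
    have hk : k + 1 ≤ T.len := Finset.mem_range.1 hk
    split_ifs with hd
    · change _ = (v _).1.2.2 _
      conv_rhs => rw [hv _ (hd.mem (by omega) hk).2]
      simp only [certMech, T.val_pos hk]
    · rfl
  · intro κ h0 hκ hd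
    have hnX : T.node κ ∉ X := fun h =>
      HiddenPath.notMem_observed_of_not_displays hd h0 hκ (hX _ h)
    change (v _).2.2 _ = _
    conv_lhs => rw [hv _ hnX]
    simp only [certMech, T.val_pos hκ.le]

theorem claim_natural (hq0 : q 0 = z) (hv : ∀ i, v i = certMech q i v ω) :
    claim q (fun i => (v i).1) =
      ((v z).1.1, T.secret (hid v) (exo ω) 0 (v z).1.1) := by
  suffices h : ∀ μ ≤ m, (v (q μ)).1.2.1 (T.pos m μ) =
      ((v z).1.1, T.secret (hid v) (exo ω) 0 (v z).1.1) from h m le_rfl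
  intro μ
  induction μ with
  | zero =>
    intro _
    rw [hq0]
    conv_lhs => rw [hv z]
    have : (v z).1.1 = (𝒢.mech z (base v) fun s => (ω s).1).1 := by
      conv_lhs => rw [hv z]
      rfl
    simp only [certMech, T.val_pos (Nat.zero_le m), hq0, if_true, this]
  | succ μ ih =>
    intro hμ
    conv_lhs => rw [hv (q (μ + 1))]
    simp only [certMech, T.val_pos hμ, if_true, Nat.add_sub_cancel, Nat.succ_ne_zero, if_false]
    exact ih (by omega)

end Natural

theorem certMech_congr (hq0 : q 0 = z) (hq : ∀ k < m, G.dir (q k) (q (k + 1))) {i : V}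
    {v v' : V → 𝒢.CertPub T m × 𝒢.CertHid T} {ω ω' : V × V → 𝒢.CertNoise T}
    (hv : ∀ w, G.dir w i → v w = v' w) (hω : ∀ s ∈ G.sites i, ω s = ω' s) :
    certMech q i v ω = certMech q i v' ω' := by
  have h := 𝒢.mech_congr i (base v) (base v') (fun s => (ω s).1) (fun s => (ω' s).1)
    (fun w hw => by simp [base, hv w hw]) fun s hs => by rw [hω s hs]
  have hh : ∀ w, G.dir w i → hid v w = hid v' w := fun w hw => by
    funext k
    simp [hid, hv w hw]
  have he : ∀ s ∈ G.sites i, exo ω s = exo ω' s := fun s hs => by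
    funext k
    simp [exo, hω s hs]
  have hdisp : (fun κ : Fin (T.len + 1) => T.displayTrack (hid v) (exo ω) i κ) =
      fun κ : Fin (T.len + 1) => T.displayTrack (hid v') (exo ω') i κ :=
    funext fun κ => HiddenPath.displayTrack_congr hh he κ
  have hhid : (fun κ : Fin (T.len + 1) => T.hiddenTrack (hid v) (exo ω) i κ) =
      fun κ : Fin (T.len + 1) => T.hiddenTrack (hid v') (exo ω') i κ :=
    funext fun κ => HiddenPath.hiddenTrack_congr hh he κ
  unfold certMech
  simp only [h, hdisp, hhid]
  congr 3
  funext μ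
  split_ifs with h1 h2
  · rw [h2, hq0] at h1
    subst h1
    rw [HiddenPath.secret_congr_source (T := T) (k := 0) (fun _ => T.head)
      (by rwa [T.node_zero]) (by rwa [T.node_zero])]
  · obtain ⟨k, hk⟩ := Nat.exists_eq_succ_of_ne_zero h2
    have := hq k (by omega)
    rw [hk, Nat.succ_sub_one, hv (q k) (by rwa [← h1, hk])]
  · rfl

/-- The game in which the public value of `z` is reported by way of the action `x`, and protected
by a random function shared by `z` and a node after `x`. -/
noncomputable def certify (𝒢 : G.Game) (T : HiddenPath G X S x z)
    (hX : ∀ x ∈ X, x ∈ G.observed) (m : ℕ) (q : ℕ → V) (hq0 : q 0 = z)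
    (hq : ∀ k < m, G.dir (q k) (q (k + 1))) : G.Game where
  Pub := 𝒢.CertPub T m
  Hid := 𝒢.CertHid T
  Noise := 𝒢.CertNoise T
  finite_pub := inferInstance
  finite_hid := inferInstance
  finite_noise := inferInstance
  nonempty_pub := inferInstance
  nonempty_hid := inferInstance
  nonempty_noise := inferInstance
  mech := certMech q
  mech_congr i v v' ω ω' hv hω := certMech_congr hq0 hq hv hω
  hid_observed i hi := by
    obtain ⟨h, hh⟩ := 𝒢.hid_observed i hi
    refine ⟨(h, fun _ => 0), fun v ω => Prod.ext (hh _ _) (funext fun κ => ?_)⟩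
    refine if_neg ?_
    rintro ⟨rfl, h0, hκ, hd⟩
    exact HiddenPath.notMem_observed_of_not_displays hd h0 hκ hi
  test p := (claim q p).2 = revealed p (claim q p).1 ∧
    open Classical in 𝒢.test (Function.update (fun i => (p i).1) z (claim q p).1)
  test_natural v ω hv := by
    have h := 𝒢.test_natural (base v) (fun s => (ω s).1) fun i => by
      conv_lhs => rw [base, hv i]
      rfl
    rw [claim_natural hq0 hv, ← secret_eq_revealed (ω := ω) hX fun i _ => hv i]
    refine ⟨rfl, ?_⟩
    rw [Function.update_eq_self_iff.2 rfl]
    exact h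

section Swap

variable [Finite V]

open Classical in
/-- Shifting all exogenous secrets by the indicator of `c`. -/
noncomputable def swap (ω : V × V → 𝒢.CertNoise T) (c : 𝒢.Pub) (s : V × V) : 𝒢.CertNoise T :=
  ((ω s).1, fun κ => (ω s).2 κ + Pi.single c 1)

variable {v v' : V → 𝒢.CertPub T m × 𝒢.CertHid T} {ω : V × V → 𝒢.CertNoise T} {c : 𝒢.Pub}

open Classical in
/-- Unless `z` tags the message `c`, the shift of the secrets at `c` is not visible to anybody
before the last node of the hidden path. -/
theorem swap_invisible (hX : ∀ x ∈ X, x ∈ G.observed) (hq0 : q 0 = z)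
    (hq : ∀ k < m, G.dir (q k) (q (k + 1)))
    (hv : ∀ i ∉ X, v i = certMech q i v ω) (hv' : ∀ i ∉ X, v' i = certMech q i v' (swap ω c))
    (hact : ∀ i ∈ X, (∀ w < i, (v' w).1 = (v w).1) → v' i = v i)
    (hz : z ∈ X ∨ (v z).1.1 ≠ c) (i : V) (hi : i < T.node T.len) :
    (v' i).1 = (v i).1 ∧ (v' i).2.1 = (v i).2.1 ∧
      ∀ κ, 0 < κ → κ < T.len → ¬ T.Displays κ → T.node κ = i →
        hid v' (T.node κ) κ = hid v (T.node κ) κ + Pi.single c 1 := by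
  induction i using WellFoundedLT.induction with
  | ind i ih =>
    by_cases hiX : i ∈ X
    · have h := hact i hiX fun w hw => (ih w hw (hw.trans hi)).1
      rw [h]
      refine ⟨rfl, rfl, fun κ h0 hκ hd hκi => ?_⟩
      exact (HiddenPath.notMem_observed_of_not_displays hd h0 hκ (hκi ▸ hX i hiX)).elim
    · have hω : ∀ s k, exo (swap ω c) s k = exo ω s k + Pi.single c 1 := fun s k => rfl
      have hhid : ∀ κ, 0 < κ → κ < T.len → ¬ T.Displays κ → T.node κ < i →
          hid v' (T.node κ) κ = hid v (T.node κ) κ + Pi.single c 1 :=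
        fun κ h0 hκ hd hlt => (ih _ hlt (hlt.trans hi)).2.2 κ h0 hκ hd rfl
      have ho := 𝒢.mech_congr i (base v') (base v) (fun s => (swap ω c s).1) (fun s => (ω s).1)
        (fun w hw => by
          have hwi := G.dir_lt _ _ hw
          have := ih w hwi (hwi.trans hi)
          rw [base, base, this.1, this.2.1]) fun s _ => rfl
      rw [hv' i hiX]
      have hvi := hv i hiX
      refine ⟨?_, ?_, fun κ h0 hκ hd hκi => ?_⟩
      · rw [hvi]
        refine Prod.ext (by simp only [certMech, ho]) (Prod.ext (funext fun μ => ?_) (funext fun κ => ?_))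
        · simp only [certMech, ho]
          split_ifs with h1 h2
          · rw [h2, hq0] at h1
            subst h1
            rw [HiddenPath.secret_zero_shift hω hhid]
            have hb : (𝒢.mech z (base v) fun s => (ω s).1).1 ≠ c := by
              have := hz.resolve_left hiX
              rw [hvi] at this
              exact this
            simp [hb]
          · obtain ⟨k, hk⟩ := Nat.exists_eq_succ_of_ne_zero h2
            have hlt : q k < i := by
              have := G.dir_lt _ _ (hq k (by omega))
              rwa [← h1, hk]
            rw [hk, Nat.succ_sub_one, (ih _ hlt (hlt.trans hi)).1]
          · rfl
        · exact HiddenPath.displayTrack_shift hω (CharTwo.add_self_eq_zero _) hhid hi κ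
      · rw [hvi]
        exact congrArg Prod.snd ho
      · have h := HiddenPath.hiddenTrack_shift hω hhid hκi h0 hκ hd
        rw [hκi]
        simp only [hid]
        rw [hv' i hiX, hvi]
        simpa [certMech, T.val_pos hκ.le] using h

/-- The action `x` can pass the check only by reporting the true public value of `z`. If `z` is an
action, it cannot pass the check at all. -/
theorem claim_eq (hX : ∀ x ∈ X, x ∈ G.observed) (hq0 : q 0 = z)
    (hq : ∀ k < m, G.dir (q k) (q (k + 1))) (hqm : q m = x)
    {ρ : (V × V → 𝒢.CertNoise T) → V → 𝒢.CertPub T m × 𝒢.CertHid T}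
    (hρ : (𝒢.certify T hX m q hq0 hq).IsPlay X ρ)
    (htest : ∀ ω, (claim q fun i => (ρ ω i).1).2 =
      revealed (fun i => (ρ ω i).1) (claim q fun i => (ρ ω i).1).1) :
    z ∉ X ∧ (ρ ω z).1.1 = (claim q fun i => (ρ ω i).1).1 := by
  classical
  by_contra hne
  set c := (claim q fun i => (ρ ω i).1).1 with hc
  have hz : z ∈ X ∨ (ρ ω z).1.1 ≠ c := by
    by_cases hzX : z ∈ X
    · exact Or.inl hzX
    · exact Or.inr fun h => hne ⟨hzX, h⟩
  have key := swap_invisible (v := ρ ω) (v' := ρ (swap ω c)) hX hq0 hq (hρ.1 ω)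
    (hρ.1 (swap ω c)) (fun i hi hw => hρ.2 _ _ i hi hw) hz
  have hxl := T.lt_last
  have hclaim : claim q (fun i => (ρ (swap ω c) i).1) = claim q fun i => (ρ ω i).1 := by
    simp only [claim, hqm, (key x hxl).1]
  have hs : T.secret (hid (ρ (swap ω c))) (exo (swap ω c)) 0 =
      T.secret (hid (ρ ω)) (exo ω) 0 + Pi.single c 1 := by
    refine HiddenPath.secret_zero_shift (fun s k => rfl) fun κ h0 hκ hd _ => ?_
    exact (key _ (HiddenPath.lt_last_of_lt hκ)).2.2 κ h0 hκ hd rfl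
  have h1 := htest ω
  have h2 := htest (swap ω c)
  rw [hclaim, ← secret_eq_revealed hX (hρ.1 (swap ω c)), hs] at h2
  rw [← secret_eq_revealed hX (hρ.1 ω)] at h1
  rw [h1, ← hc] at h2
  simp at h2

end Swap

theorem certify_test_congr (hX : ∀ x ∈ X, x ∈ G.observed) (hq0 : q 0 = z)
    (hq : ∀ k < m, G.dir (q k) (q (k + 1))) (hqm : q m = x) (hx : x ∈ S)
    (h𝒢 : ∀ p p', (∀ s ∈ insert z S, p s = p' s) → 𝒢.test p → 𝒢.test p')
    {p p' : V → 𝒢.CertPub T m} (hp : ∀ s ∈ S, p s = p' s)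
    (h : (𝒢.certify T hX m q hq0 hq).test p) : (𝒢.certify T hX m q hq0 hq).test p' := by
  have hc : claim q p = claim q p' := by rw [claim, claim, hqm, hp x hx]
  have hr : revealed p = revealed p' := by
    refine Finset.sum_congr rfl fun k hk => ?_
    split_ifs with hd
    · rw [hp _ (hd.mem (by omega) (Finset.mem_range.1 hk)).1]
    · rfl
  refine ⟨?_, h𝒢 _ _ (fun s hs => ?_) h.2⟩
  · rw [← hc, ← hr]
    exact h.1
  · by_cases hsz : s = z
    · subst hsz
      simp [hc]
    · simp [hsz, hp s (hs.resolve_left hsz)]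

end Game

variable [Finite V]

theorem Hard.of_exposed (hX : ∀ x ∈ X, x ∈ G.observed) (h : G.Exposed X S) : G.Hard X S := by
  obtain ⟨z, hz, x, hx, hxX, hzx, hl⟩ := h
  obtain ⟨T⟩ := hl.nonempty_hiddenPath
  obtain ⟨m, q, hq0, hqm, hq⟩ := exists_path_of_reflTransGen hzx
  refine ⟨(Game.trivialGame G).certify T hX m q hq0 hq, fun p p' hp =>
    Game.certify_test_congr hX hq0 hq hqm hx (fun _ _ _ h => h) hp, fun ρ hρ => ?_⟩
  by_contra! hne
  exact (Game.claim_eq (ω := fun _ => Classical.arbitrary _) hX hq0 hq hqm hρ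
    fun ω => (hne ω).1).1 hz

theorem Hard.of_link (hX : ∀ x ∈ X, x ∈ G.observed) (hx : x ∈ S)
    (hzx : Relation.ReflTransGen G.dir z x) (hl : G.Link X S x true z)
    (h : G.Hard X (insert z S)) : G.Hard X S := by
  obtain ⟨𝒢, h𝒢, hard⟩ := h
  obtain ⟨T⟩ := hl.nonempty_hiddenPath
  obtain ⟨m, q, hq0, hqm, hq⟩ := exists_path_of_reflTransGen hzx
  refine ⟨𝒢.certify T hX m q hq0 hq, fun p p' hp =>
    Game.certify_test_congr hX hq0 hq hqm hx h𝒢 hp, fun ρ hρ => ?_⟩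
  by_contra! hne
  -- all exogenous secrets are fixed to zero, so that the certificates are public knowledge
  let lift : (V × V → 𝒢.Noise) → V × V → 𝒢.CertNoise T := fun ω s => (ω s, fun _ => 0)
  suffices hplay : 𝒢.IsPlay X fun ω => Game.base (ρ (lift ω)) by
    obtain ⟨ω, hω⟩ := hard _ hplay
    have hc := Game.claim_eq (ω := lift ω) hX hq0 hq hqm hρ fun ω => (hne ω).1
    have ht := (hne (lift ω)).2
    rw [← hc.2, Function.update_eq_self_iff.2 rfl] at ht
    exact hω ht
  refine ⟨fun ω i hi => ?_, ?_⟩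
  · exact congrArg (fun o => (o.1.1, o.2.1)) (hρ.1 (lift ω) i hi)
  · intro ω ω' i hi hpast
    suffices h : ∀ w, w < i → (ρ (lift ω) w).1 = (ρ (lift ω') w).1 ∧
        (ρ (lift ω) w).2.2 = (ρ (lift ω') w).2.2 by
      simp only [Game.base]
      rw [hρ.2 _ _ i hi fun w hw => (h w hw).1]
    intro w
    induction w using WellFoundedLT.induction with
    | ind w ih =>
      intro hw
      by_cases hwX : w ∈ X
      · rw [hρ.2 _ _ w hwX fun y hy => (ih y hy (hy.trans hw)).1]
        exact ⟨rfl, rfl⟩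
      · have hm : ρ (lift ω) w = Game.certMech q w (ρ (lift ω)) (lift ω) := hρ.1 _ w hwX
        have hm' : ρ (lift ω') w = Game.certMech q w (ρ (lift ω')) (lift ω') := hρ.1 _ w hwX
        have hh : ∀ y, G.dir y w → Game.hid (ρ (lift ω)) y = Game.hid (ρ (lift ω')) y :=
          fun y hy => by
            have hyw := G.dir_lt _ _ hy
            funext k
            simp only [Game.hid, (ih y hyw (hyw.trans hw)).2]
        have he : ∀ s ∈ G.sites w, Game.exo (lift ω) s = Game.exo (lift ω') s := fun _ _ => rfl
        have h1 : (ρ (lift ω) w).1.1 = (ρ (lift ω') w).1.1 := hpast w hw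
        refine ⟨Prod.ext h1 (Prod.ext (funext fun μ => ?_) (funext fun κ => ?_)), ?_⟩
        · have ho : (𝒢.mech w (Game.base (ρ (lift ω))) fun s => (lift ω s).1).1 =
              (𝒢.mech w (Game.base (ρ (lift ω'))) fun s => (lift ω' s).1).1 := by
            rw [hm, hm'] at h1
            exact h1
          rw [hm, hm']
          simp only [Game.certMech, ho]
          split_ifs with h2 h3
          · rw [h3, hq0] at h2
            subst h2
            rw [HiddenPath.secret_congr_source (T := T) (k := 0) (fun _ => T.head)
              (by rwa [T.node_zero]) (by rwa [T.node_zero])]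
          · obtain ⟨k, hk⟩ := Nat.exists_eq_succ_of_ne_zero h3
            have hlt : q k < w := by
              have := G.dir_lt _ _ (hq k (by omega))
              rwa [← h2, hk]
            rw [hk, Nat.succ_sub_one, (ih _ hlt (hlt.trans hw)).1]
          · rfl
        · rw [hm, hm']
          exact HiddenPath.displayTrack_congr hh he κ
        · rw [hm, hm']
          exact funext fun κ => HiddenPath.hiddenTrack_congr hh he κ

/-- Starting from the target alone, relevant nodes are added as long as there are any. Either this
ends in a closed set without exposed action, or some action becomes exposed, which makes the
last set hard and, backwards through the additions, `{Y}` as well. -/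
theorem hard_or_exists_closed {Y : V} (hX : ∀ x ∈ X, x ∈ G.observed) :
    G.Hard X {Y} ∨ ∃ S : Set V, Y ∈ S ∧ (∀ s ∈ S, s ≤ Y) ∧
      (∀ v, G.Relevant X S v → v ∈ S) ∧ ¬ G.Exposed X S := by
  by_cases hgood : ∃ S : Set V, Y ∈ S ∧ (∀ s ∈ S, s ≤ Y) ∧
      (∀ v, G.Relevant X S v → v ∈ S) ∧ ¬ G.Exposed X S
  · exact Or.inr hgood
  left
  suffices h : ∀ S : Set V, Y ∈ S → (∀ s ∈ S, s ≤ Y) → G.Hard X S from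
    h {Y} rfl (by simp)
  intro S
  induction S using WellFoundedGT.induction with
  | ind S ih =>
    intro hY hle
    by_cases hex : G.Exposed X S
    · exact Hard.of_exposed hX hex
    · have : ∃ v, G.Relevant X S v ∧ v ∉ S := by
        by_contra! hcl
        exact hgood ⟨S, hY, hle, hcl, hex⟩
      obtain ⟨v, hv, hvS⟩ := this
      have hlt : S < insert v S := Set.ssubset_insert hvS
      rcases hv with ⟨n, hn, hnX, hvn⟩ | ⟨-, -, x, hx, -, hvx, hpath, hl⟩
      · refine Hard.of_parent hn hnX hvn (ih _ hlt (Or.inr hY) ?_)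
        rintro s (rfl | hs)
        · exact (G.dir_lt _ _ hvn).le.trans (hle n hn)
        · exact hle s hs
      · refine Hard.of_link hX hx hpath hl (ih _ hlt (Or.inr hY) ?_)
        rintro s (rfl | hs)
        · exact hvx.le.trans (hle x hx)
        · exact hle s hs

end CausalDiagram

/-! ### From games to structural causal models -/

namespace CausalDiagram

variable {V : Type u} [LinearOrder V]

/-- Mechanisms that look only at earlier nodes have a joint solution. -/
theorem exists_solution [WellFoundedLT V] {D : Type*} [Nonempty D] (F : V → (V → D) → D)
    (hF : ∀ i v v', (∀ w < i, v w = v' w) → F i v = F i v') : ∃ v : V → D, ∀ i, v i = F i v := by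
  classical
  refine ⟨WellFoundedLT.fix fun i v => F i fun w => if h : w < i then v w h else
    Classical.arbitrary D, fun i => ?_⟩
  rw [WellFoundedLT.fix_eq]
  exact hF i _ _ fun w hw => by simp [hw]

variable [Fintype V] {G : CausalDiagram V} {X : Finset V}

open Classical in
/-- The structural causal model of a game, with uniform exogenous variables. -/
noncomputable def Game.scm (𝒢 : G.Game) : SCM V fun _ => 𝒢.Pub × 𝒢.Hid where
  Exo := V × V
  exoFintype := inferInstance
  exoDom _ := 𝒢.Noise
  exoDomFintype _ := Fintype.ofFinite _
  exoDist _ :=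
    letI := Fintype.ofFinite 𝒢.Noise
    ⟨fun _ => (Fintype.card 𝒢.Noise : ℝ)⁻¹, by
      refine ⟨fun _ => by positivity, ?_⟩
      simp⟩
  pa i := {w | G.dir w i}
  exoArgs i := G.sites i
  func i v ω := 𝒢.mech i
    (fun w => if h : G.dir w i then v ⟨w, h⟩ else Classical.arbitrary _)
    (fun s => if h : s ∈ G.sites i then ω ⟨s, h⟩ else Classical.arbitrary _)

theorem Game.scm_func (𝒢 : G.Game) (i : V) (v : V → 𝒢.Pub × 𝒢.Hid) (ω : V × V → 𝒢.Noise) :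
    𝒢.scm.func i (fun w => v w.1) (fun s => ω s.1) = 𝒢.mech i v ω :=
  𝒢.mech_congr _ _ _ _ _ (fun w hw => by simp [hw]) (fun s hs => by simp [hs])

theorem Game.scm_compatible (𝒢 : G.Game) : 𝒢.scm.Compatible G := by
  refine ⟨fun a b => Iff.rfl, fun a b => ⟨fun h => ⟨?_, (a, b), ?_, ?_⟩, ?_⟩⟩
  · rintro rfl
    exact G.bi_irrefl _ h
  · exact ⟨Or.inl rfl, Or.inr h⟩
  · exact ⟨Or.inr rfl, Or.inr h⟩
  · rintro ⟨hne, ⟨c, d⟩, ⟨h1, h2⟩, ⟨h3, -⟩⟩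
    dsimp only at h1 h2 h3
    rcases h1 with rfl | rfl <;> rcases h3 with rfl | rfl
    · exact (hne rfl).elim
    · exact h2.resolve_left hne
    · exact G.bi_symm _ _ (h2.resolve_left hne.symm)
    · exact (hne rfl).elim

theorem Game.exoDist_pos (𝒢 : G.Game) (u : ∀ e, 𝒢.scm.exoDom e) :
    0 < ∏ e, (𝒢.scm.exoDist e).1 (u e) := by
  refine Finset.prod_pos fun e _ => ?_
  let := Fintype.ofFinite 𝒢.Noise
  change (0 : ℝ) < (Fintype.card 𝒢.Noise : ℝ)⁻¹
  have : 0 < Fintype.card 𝒢.Noise := Fintype.card_pos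
  positivity

/-- Values of positive probability are natural, so they pass the test. -/
theorem Game.test_of_prob_ne_zero (𝒢 : G.Game) {v : V → 𝒢.Pub × 𝒢.Hid} (h : 𝒢.scm.prob v ≠ 0) :
    𝒢.test fun i => (v i).1 := by
  obtain ⟨u, -, hu⟩ := Finset.exists_ne_zero_of_sum_ne_zero h
  refine 𝒢.test_natural v u fun i => ?_
  have := Finset.prod_ne_zero_iff.1 (right_ne_zero_of_mul hu) i (Finset.mem_univ i)
  rw [← 𝒢.scm_func i v u]
  by_contra hne
  exact this (if_neg hne)

/-- A policy supports a play: every action takes a value that its decision rule gives positive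
probability. -/
theorem Game.exists_play (𝒢 : G.Game) [Fintype (𝒢.Pub × 𝒢.Hid)]
    (π : Policy G X fun _ => 𝒢.Pub × 𝒢.Hid) :
    ∃ ρ, 𝒢.IsPlay X ρ ∧ ∀ ω, 0 < 𝒢.scm.probDo π (ρ ω) := by
  classical
  have hsupp : ∀ i (h : i ∈ X) (c : π.cov i → 𝒢.Pub × 𝒢.Hid), ∃ d, 0 < (π.rule i h c).1 d := by
    intro i h c
    by_contra! hle
    have h1 := (π.rule i h c).2.2
    have h2 : ∑ d, (π.rule i h c).1 d ≤ 0 := Finset.sum_nonpos fun d _ => hle d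
    linarith
  choose g hg using hsupp
  have hsol : ∀ ω : V × V → 𝒢.Noise, ∃ v : V → 𝒢.Pub × 𝒢.Hid, ∀ i, v i =
      if h : i ∈ X then g i h fun z => v z else 𝒢.mech i v ω := by
    intro ω
    refine exists_solution (fun i v => if h : i ∈ X then g i h fun z => v z else 𝒢.mech i v ω)
      fun i v v' hv => ?_
    split_ifs with h
    · congr 1
      funext z
      exact hv z (π.cov_subset i h z.2).2
    · exact 𝒢.mech_congr _ _ _ _ _ (fun w hw => hv w (G.dir_lt _ _ hw)) fun _ _ => rfl
  choose ρ hρ using hsol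
  have hnat : ∀ ω, ∀ i ∉ X, ρ ω i = 𝒢.mech i (ρ ω) ω := fun ω i hi => by
    rw [hρ ω i, dif_neg hi]
  have hact : ∀ ω, ∀ i (hi : i ∈ X), ρ ω i = g i hi fun z => ρ ω z := fun ω i hi => by
    rw [hρ ω i, dif_pos hi]
  refine ⟨ρ, ⟨hnat, fun ω ω' i hi hpast => ?_⟩, fun ω => ?_⟩
  · -- at observed nodes the hidden part is determined by the public past
    have hobs : ∀ w, w < i → w ∈ G.observed → ρ ω w = ρ ω' w := by
      intro w
      induction w using WellFoundedLT.induction with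
      | ind w ih =>
        intro hw hO
        by_cases hwX : w ∈ X
        · rw [hact ω w hwX, hact ω' w hwX]
          congr 1
          funext z
          have hz := π.cov_subset w hwX z.2
          exact ih z hz.2 (lt_trans hz.2 hw) hz.1
        · obtain ⟨h, hh⟩ := 𝒢.hid_observed w hO
          refine Prod.ext (hpast w hw) ?_
          rw [hnat ω w hwX, hnat ω' w hwX, hh, hh]
    rw [hact ω i hi, hact ω' i hi]
    congr 1
    funext z
    have hz := π.cov_subset i hi z.2
    exact hobs z hz.2 hz.1
  · refine Finset.sum_pos' (fun u _ => mul_nonneg (𝒢.exoDist_pos u).le ?_)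
      ⟨ω, Finset.mem_univ _, mul_pos (𝒢.exoDist_pos ω) (Finset.prod_pos fun i _ => ?_)⟩
    · refine Finset.prod_nonneg fun i _ => ?_
      split_ifs with h
      · exact (π.rule i h _).2.1 _
      · exact zero_le_one
      · exact le_rfl
    · by_cases h : i ∈ X
      · rw [dif_pos h, hact ω i h]
        exact hg i h _
      · rw [dif_neg h, if_pos]
        · exact zero_lt_one
        · rw [𝒢.scm_func i (ρ ω) ω]
          exact hnat ω i h

theorem probDo_nonneg {dom : V → Type} [∀ i, Fintype (dom i)] (M : SCM V dom)
    (π : Policy G X dom) (v : ∀ i, dom i) : 0 ≤ M.probDo π v := by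
  classical
  refine Finset.sum_nonneg fun u _ => mul_nonneg
    (Finset.prod_nonneg fun e _ => (M.exoDist e).2.1 _) (Finset.prod_nonneg fun i _ => ?_)
  split_ifs with h
  · exact (π.rule i h _).2.1 _
  · exact zero_le_one
  · exact le_rfl

/-- A hard game whose test reads only the target gives a single model in which every policy changes
the distribution of the target. -/
theorem Hard.not_imitable {Y : V} (h : G.Hard X {Y}) : ¬ G.Imitable X Y := by
  classical
  obtain ⟨𝒢, hS, hard⟩ := h
  let : Fintype (𝒢.Pub × 𝒢.Hid) := Fintype.ofFinite _
  intro himit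
  obtain ⟨π, hπ⟩ := himit (fun _ => 𝒢.Pub × 𝒢.Hid) (marginal 𝒢.scm.prob G.observed)
  have heq := hπ 𝒢.scm 𝒢.scm_compatible rfl
  obtain ⟨ρ, hρ, hpos⟩ := 𝒢.exists_play π
  obtain ⟨ω, hω⟩ := hard ρ hρ
  have heq := congrFun heq fun i => ρ ω i
  have hzero : marginal 𝒢.scm.prob {Y} (fun i => ρ ω i) = 0 := by
    refine Finset.sum_eq_zero fun v _ => ?_
    split_ifs with hv
    · by_contra hne
      refine hω (hS _ _ ?_ (𝒢.test_of_prob_ne_zero hne))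
      rintro s rfl
      rw [hv ⟨s, rfl⟩]
    · rfl
  have hpos' : 0 < marginal (𝒢.scm.probDo π) {Y} fun i => ρ ω i := by
    refine Finset.sum_pos' (fun v _ => ?_) ⟨ρ ω, Finset.mem_univ _, ?_⟩
    · split_ifs
      · exact probDo_nonneg _ _ _
      · exact le_rfl
    · rw [if_pos fun _ => rfl]
      exact hpos ω
  rw [heq, hzero] at hpos'
  exact lt_irrefl _ hpos'

end CausalDiagram

theorem mainTheorem2 {V : Type u} [Fintype V] [LinearOrder V] (G : CausalDiagram V)
    (X : Finset V) (Y : V) (hX : ∀ x ∈ X, x ∈ G.observed) (hY : Y ∉ X)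
    (h : ¬ ∃ Z : V → Set V, G.IsSeqPiBackdoor X Y Z) :
    ¬ G.Imitable X Y := by
  rcases G.hard_or_exists_closed (Y := Y) hX with hard | ⟨S, hYS, hle, hcl, hex⟩
  · exact hard.not_imitable
  · exact (h ⟨_, CausalDiagram.isSeqPiBackdoor_closureCov hX hcl hex hYS hY hle⟩).elim
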